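/- Let $H$ and $E$ be separable real Hilbert spaces, let $V$ be a Banach space that is compactly and densely embedded in $H$, let $S:H\times E\to V$ be a map, and let $(\eta_k)_{k\ge1}$ be i.i.d. random variables in $E$ with law $\ell$ and $\mathcal K:=\operatorname{supp}\ell$. Consider the random dynamical system $$u_k=S(u_{k-1},\eta_k),\qquad k\ge1,$$ in $H$. Assume: (A1) $S:H\times E\to V$ is twice continuously differentiable, and its derivatives up to second order are bounded on bounded sets. (H1) There are an orthonormal basis $(e_j)$ of $E$, real numbers $b_j\neq0$ with $\sum_j b_j^2<\infty$, and independent real random variables $\xi_{jk}$ with $|\xi_{jk}|\le1$ a.s. such that $\eta_k=\sum_j b_j\xi_{jk}e_j$; the law of $\xi_{jk}$ is $\rho_j(r)\,dr$, where $\rho_j:\mathbb R\to\mathbb R$ is Lipschitz and $\rho_j(0)\ne0$. (H2) For some $0<\gamma<1$ and $\beta>0$: $\|S(u,\eta)\|_H\le\gamma\|u\|_H+\beta$ and $\|S(u,0)\|_H\le\gamma\|u\|_H$ for all $u\in H$, $\eta\in\mathcal K$. (H3) For all $u\in H$ and $\eta\in\mathcal K$ the image of $D_\eta S(u,\eta):E\to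 V$ is dense in $H$. For a Borel probability measure $\mu$ on $H$ let $\mathcal P_k^*\mu$ be the law of $u_k$ when $u_0$ has law $\mu$ and is independent of $(\eta_k)_{k\ge1}$. Let $\|\mu-\nu\|_L^*$ be the supremum of $|\int f\,d\mu-\int f\,d\nu|$ over all $f:H\to\mathbb R$ with $\sup|f|\le1$ and $\operatorname{Lip}(f)\le1$, and let $B_H(R)$ be the closed $R$-ball of $H$ centred at $0$. Then: 1. The system defines a Markov chain in $H$: whenever $u_0$ is independent of the noise, $(u_k)_{k\ge 0}$ is a time-homogeneous Markov chain whose transition probability $P_k(u,\cdot)$ after $k$ steps is the law of $u_k$ started at $u_0=u$. It has a unique stationary probability measure $\mu_*$. 2. $\mu_*$ is supported by $B_H(R_*^0)$, where $R_*^0:=\beta/(1-\gamma)$. 3. For every $R_*\ge R_*^0$ there are $C>0$ and $\kappa\in(0,1)$, depending on $R_*$ but not on $\mu$, such that for every Borel probability measure $\mu$ supported by $B_H(R_*)$ $$\|\mathcal P_k^*\mu-\mu_*\|_L^*\le C\kappa^k\qquad\forall\,k\ge1.$$ 4. For every Borel probability measure $\nu$ on $H$, $\mathcal P_k^*\nu$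 converges weakly to $\mu_*$ as $k\to\infty$. -/

import Mathlib

open MeasureTheory ProbabilityTheory Filter Topology

noncomputable section

namespace RDS

/-- `V` is compactly and densely embedded in `H`, the embedding being `emb`. -/
structure IsCompactDenseEmbedding {V H : Type*} [NormedAddCommGroup V] [NormedSpace ℝ V]
    [NormedAddCommGroup H] [NormedSpace ℝ H] (emb : V →L[ℝ] H) : Prop where
  injective : Function.Injective emb
  compact : IsCompactOperator emb
  dense : DenseRange emb

/-- (A1): `S : H × E → V` is `C²` and its derivatives of first and second order are bounded on
bounded sets (so that `S` itself is bounded on bounded sets as well). -/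
structure Regular {H E V : Type*} [NormedAddCommGroup H] [NormedSpace ℝ H]
    [NormedAddCommGroup E] [NormedSpace ℝ E] [NormedAddCommGroup V] [NormedSpace ℝ V]
    (S : H × E → V) : Prop where
  contDiff : ContDiff ℝ 2 S
  bounded : ∀ B : Set (H × E), Bornology.IsBounded B →
    ∃ C : ℝ, ∀ z ∈ B, ‖fderiv ℝ S z‖ ≤ C ∧ ‖fderiv ℝ (fderiv ℝ S) z‖ ≤ C

/-- The random variables `η 0, η 1, …` are i.i.d. with common law `ℓ`. -/
structure IsIIDWithLaw {Ω E : Type*} [MeasurableSpace Ω] [MeasurableSpace E]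
    (Pr : Measure Ω) (η : ℕ → Ω → E) (ℓ : Measure E) : Prop where
  measurable : ∀ k, Measurable (η k)
  indep : iIndepFun η Pr
  law : ∀ k, Pr.map (η k) = ℓ

/-- (H1): `η_k = ∑_j b_j ξ_{jk} e_j` almost surely, where `(e_j)` is an orthonormal basis of `E`,
the `b_j` are nonzero with `∑_j b_j² < ∞`, and the `ξ_{jk}` are independent real random variables,
bounded by `1`, whose law has a Lipschitz density `ρ_j` with `ρ_j(0) ≠ 0`. -/
def Decomposable (ι : Type*) {Ω E : Type*} [MeasurableSpace Ω] [NormedAddCommGroup E]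
    [InnerProductSpace ℝ E] (Pr : Measure Ω) (η : ℕ → Ω → E) : Prop :=
  ∃ (e : HilbertBasis ι ℝ E) (b : ι → ℝ) (ξ : ι → ℕ → Ω → ℝ) (ρ : ι → ℝ → ℝ),
    (∀ k, ∀ᵐ ω ∂Pr, HasSum (fun j => (b j * ξ j k ω) • e j) (η k ω)) ∧
    (∀ j, b j ≠ 0) ∧
    (Summable fun j => b j ^ 2) ∧
    (∀ j k, Measurable (ξ j k)) ∧
    iIndepFun (fun p : ι × ℕ => ξ p.1 p.2) Pr ∧
    (∀ j k, ∀ᵐ ω ∂Pr, |ξ j k ω| ≤ 1) ∧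
    (∀ j r, 0 ≤ ρ j r) ∧
    (∀ j k, Pr.map (ξ j k) = volume.withDensity fun r => ENNReal.ofReal (ρ j r)) ∧
    (∀ j, ∃ L, LipschitzWith L (ρ j)) ∧
    (∀ j, ρ j 0 ≠ 0)

/-- (H2), with constants `γ` and `β`, for the map `F : H × E → H`; `K` is the support of the law of
the noise. -/
structure Dissipative {H E : Type*} [NormedAddCommGroup H] [NormedAddCommGroup E]
    (F : H × E → H) (K : Set E) (γ β : ℝ) : Prop where
  gamma_pos : 0 < γ
  gamma_lt_one : γ < 1
  beta_pos : 0 < β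
  bound : ∀ u : H, ∀ ζ ∈ K, ‖F (u, ζ)‖ ≤ γ * ‖u‖ + β
  bound_zero : ∀ u : H, ‖F (u, 0)‖ ≤ γ * ‖u‖

/-- (H3): for `u ∈ H` and `ζ ∈ K` the image of `D_η S(u, ζ) : E → V` is dense in `H`. -/
def NonDegenerate {H E V : Type*} [NormedAddCommGroup H] [NormedSpace ℝ H]
    [NormedAddCommGroup E] [NormedSpace ℝ E] [NormedAddCommGroup V] [NormedSpace ℝ V]
    (emb : V →L[ℝ] H) (S : H × E → V) (K : Set E) : Prop :=
  ∀ u : H, ∀ ζ ∈ K, DenseRange fun h : E => emb (fderiv ℝ (fun x => S (u, x)) ζ h)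

/-- The trajectory `u_0 = v`, `u_{k+1} = F(u_k, η_k)`: here `η k` is the noise that acts in the
step from time `k` to time `k + 1`. -/
def trajectory {Ω H E : Type*} (F : H × E → H) (η : ℕ → Ω → E) (v : Ω → H) : ℕ → Ω → H
  | 0 => v
  | k + 1 => fun ω => F (trajectory F η v k ω, η k ω)

/-- The transition probability after `k` steps, `P_k(u, ·)`: the law of `u_k` when `u_0 = u`. -/
def transition {Ω H E : Type*} [MeasurableSpace Ω] [MeasurableSpace H]
    (Pr : Measure Ω) (F : H × E → H) (η : ℕ → Ω → E) (k : ℕ) (u : H) : Measure H :=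
  Pr.map (trajectory F η (fun _ => u) k)

/-- `P_k^* μ`: the law of `u_k` when `u_0` has law `μ` and is independent of the noise. It is
realized on `H × Ω` with the measure `μ ⊗ Pr`, with `u_0` the first coordinate. -/
def evolve {Ω H E : Type*} [MeasurableSpace Ω] [MeasurableSpace H]
    (Pr : Measure Ω) (F : H × E → H) (η : ℕ → Ω → E) (k : ℕ) (μ : Measure H) : Measure H :=
  (μ.prod Pr).map (trajectory F (fun j (p : H × Ω) => η j p.2) Prod.fst k)

/-- `u` is a (time-homogeneous) Markov chain whose transition probability after `n` steps is
`P n x A`: for all times `k`, `n` and all measurable `A`,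
`Pr(u_{k+n} ∈ A | u_0, …, u_k) = P_n(u_k, A)` almost surely. -/
structure IsMarkovChain {Ω X : Type*} [MeasurableSpace Ω] [mX : MeasurableSpace X]
    (Pr : Measure Ω) (u : ℕ → Ω → X) (P : ℕ → X → Measure X) : Prop where
  measurable : ∀ k, Measurable (u k)
  measurable_transition : ∀ n, Measurable (P n)
  isProbabilityMeasure : ∀ n x, IsProbabilityMeasure (P n x)
  markov : ∀ (k n : ℕ) (A : Set X), MeasurableSet A →
    Pr[(u (k + n) ⁻¹' A).indicator (fun _ => (1 : ℝ)) |
        ⨆ j : Fin (k + 1), MeasurableSpace.comap (u j) mX]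
      =ᵐ[Pr] fun ω => (P n (u k ω)).real A

/-- The Lipschitz-dual distance `‖μ - ν‖_L^*`: the supremum of `|⟨μ - ν, f⟩|` over all functions
`f` with `sup |f| ≤ 1` and `Lip f ≤ 1`. -/
def lipDualDist {X : Type*} [PseudoMetricSpace X] [MeasurableSpace X] (μ ν : Measure X) : ℝ :=
  sSup {r : ℝ | ∃ f : X → ℝ, (∀ x, |f x| ≤ 1) ∧ LipschitzWith 1 f ∧
    r = |∫ x, f x ∂μ - ∫ x, f x ∂ν|}

/-- `μ` is supported by the closed ball of radius `R` centred at the origin. -/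
def SupportedByBall {H : Type*} [NormedAddCommGroup H] [MeasurableSpace H]
    (μ : Measure H) (R : ℝ) : Prop :=
  μ (Metric.closedBall (0 : H) R)ᶜ = 0

/-- Weak convergence of measures. -/
def WeaklyConverges {X : Type*} [TopologicalSpace X] [MeasurableSpace X]
    (μs : ℕ → Measure X) (μ : Measure X) : Prop :=
  ∀ f : BoundedContinuousFunction X ℝ,
    Tendsto (fun k => ∫ x, f x ∂(μs k)) atTop (𝓝 (∫ x, f x ∂μ))

end RDS

end

/-! Write `F = emb ∘ S` and let `average ℓ F` be the Markov operator of the chain. The proof is a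
local coupling argument in dual form. On a compact absorbing set, a power of this operator contracts
the best constant `a` in `|f x - f y| ≤ a * min 1 (‖x - y‖ / δ)`, which is the seminorm in
`TruncLipschitzOn`.

Close points. If `h = u' - u` is small, the noise at `u'` is corrected to `Ψ ζ ≈ ζ + G (u, ζ) h` so
that `F (u', Ψ ζ)` lies within `‖h‖ / 2` of `F (u, ζ)` (`exists_almostPreserves_halving`). Here `G`
is an approximate solution of `D_u F + D_η F ∘ G = 0`. It exists because `D_u F` is compact, so that
only finitely many directions matter, and `D_η F` has dense range. It takes values in the span of
finitely many `e j`, and a partition of unity over a compact set makes it Lipschitz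
(`exists_lipschitz_approximate_inverse`). The correction is carried out as a composition of shears
along the `e j`. As the densities `ρ j` are Lipschitz, this changes `ℓ` by only `O(‖h‖)` in total
variation (`lintegral_mul_density_le`, `shearStable_map_prod`). Halving the distance outweighs this
cost once `δ` is small, which gives the factor `3 / 4`.

Distant points. Since `0 ∈ supp ℓ` and zero noise contracts the norm by `γ`, the chain enters any
ball around `0` with a probability `p > 0` uniform over bounded sets of starting points
(`exists_visit_probability`). Two independent copies meet in a small ball with probability at least
`p ^ 2`, which gives the factor `1 - p ^ 2 / 2`.

Together these give exponential mixing (`exists_mixing_of_halving`). Compactness then produces a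
stationary measure as a weak limit, and mixing from every point, integrated over the initial law,
gives weak convergence and hence uniqueness (`exists_stationary`). -/

namespace RDS

open scoped ENNReal NNReal RealInnerProductSpace

/-! ### Independence of subfamilies and joint laws. -/

section Independence

theorem comap_subfamily_le {Ω ι α E : Type*} [MeasurableSpace E] (X : ι → Ω → E) (f : α → ι) :
    MeasurableSpace.comap (fun ω a => X (f a) ω) MeasurableSpace.pi ≤
      ⨆ i ∈ Set.range f, MeasurableSpace.comap (X i) inferInstance := by
  simp only [MeasurableSpace.pi, MeasurableSpace.comap_iSup, MeasurableSpace.comap_comp]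
  exact iSup_le fun a => le_iSup₂_of_le (f := fun i (_ : i ∈ Set.range f) =>
    MeasurableSpace.comap (X i) inferInstance) (f a) ⟨a, rfl⟩ le_rfl

variable {Ω : Type*} [MeasurableSpace Ω] {Pr : Measure Ω}

/-- Subfamilies of an independent family with disjoint index sets are independent. -/
theorem indepFun_subfamilies {ι α β E : Type*} [MeasurableSpace E] {X : ι → Ω → E}
    (hX : ∀ i, Measurable (X i)) (h : iIndepFun X Pr) (f : α → ι) (g : β → ι)
    (hfg : Disjoint (Set.range f) (Set.range g)) :
    IndepFun (fun ω a => X (f a) ω) (fun ω b => X (g b) ω) Pr := by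
  rw [IndepFun_iff_Indep]
  exact indep_of_indep_of_le_left (indep_of_indep_of_le_right
    (indep_iSup_of_disjoint (fun i => (hX i).comap_le) h hfg) (comap_subfamily_le X g))
    (comap_subfamily_le X f)

theorem indepFun_prodMk_of_indepFun [IsProbabilityMeasure Pr] {A B C : Type*} [MeasurableSpace A]
    [MeasurableSpace B] [MeasurableSpace C] {X : Ω → A} {Y : Ω → B} {Z : Ω → C} (hX : Measurable X)
    (hY : Measurable Y) (hZ : Measurable Z) (hXYZ : IndepFun X (fun ω => (Y ω, Z ω)) Pr)
    (hYZ : IndepFun Y Z Pr) : IndepFun (fun ω => (X ω, Y ω)) Z Pr := by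
  have hpX := Measure.isProbabilityMeasure_map (μ := Pr) hX.aemeasurable
  have hpY := Measure.isProbabilityMeasure_map (μ := Pr) hY.aemeasurable
  have hpZ := Measure.isProbabilityMeasure_map (μ := Pr) hZ.aemeasurable
  have hXY : IndepFun X Y Pr := hXYZ.comp measurable_id measurable_fst
  rw [indepFun_iff_map_prod_eq_prod_map_map (hX.prodMk hY).aemeasurable hZ.aemeasurable,
    (indepFun_iff_map_prod_eq_prod_map_map hX.aemeasurable hY.aemeasurable).1 hXY]
  have h1 := (indepFun_iff_map_prod_eq_prod_map_map hX.aemeasurable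
    (hY.prodMk hZ).aemeasurable).1 hXYZ
  rw [(indepFun_iff_map_prod_eq_prod_map_map hY.aemeasurable hZ.aemeasurable).1 hYZ,
    ← Measure.prodAssoc_prod] at h1
  apply MeasurableEquiv.map_measurableEquiv_injective MeasurableEquiv.prodAssoc
  rw [← h1, Measure.map_map (by fun_prop) (by fun_prop)]
  rfl

theorem measure_preimage_prodMk_eq_lintegral [IsProbabilityMeasure Pr] {A B : Type*}
    [MeasurableSpace A] [MeasurableSpace B] {X : Ω → A} {Y : Ω → B} (hX : Measurable X)
    (hY : Measurable Y) (hXY : IndepFun X Y Pr) {D : Set (A × B)} (hD : MeasurableSet D) :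
    Pr ((fun ω => (X ω, Y ω)) ⁻¹' D) = ∫⁻ ω, Pr.map Y (Prod.mk (X ω) ⁻¹' D) ∂Pr := by
  have hpY := Measure.isProbabilityMeasure_map (μ := Pr) hY.aemeasurable
  rw [← Measure.map_apply (hX.prodMk hY) hD,
    (indepFun_iff_map_prod_eq_prod_map_map hX.aemeasurable hY.aemeasurable).1 hXY,
    Measure.prod_apply hD, lintegral_map (measurable_measure_prodMk_left hD) hX]

end Independence

/-! ### Isolating one coordinate of the noise. -/

section NoiseSplitting

/-- A random series with independent coefficients is the sum of one of its terms and of a random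
variable that is independent of it. -/
theorem exists_map_eq_map_prod_add_smul {ι Ω E : Type*} [Countable ι] [MeasurableSpace Ω]
    {Pr : Measure Ω} [IsProbabilityMeasure Pr] [NormedAddCommGroup E] [NormedSpace ℝ E]
    [CompleteSpace E] [TopologicalSpace.SeparableSpace E] [MeasurableSpace E] [BorelSpace E]
    {a : ι → E} {ξ : ι → Ω → ℝ} {X : Ω → E} (hsum : ∀ᵐ ω ∂Pr, HasSum (fun j => ξ j ω • a j) (X ω))
    (hξ : ∀ j, Measurable (ξ j)) (hind : iIndepFun ξ Pr) (j : ι) :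
    ∃ ν : Measure E, IsProbabilityMeasure ν ∧
      Pr.map X = (ν.prod (Pr.map (ξ j))).map fun p => p.1 + p.2 • a j := by
  classical
  have : SecondCountableTopology E := UniformSpace.secondCountable_of_separable E
  let f : Finset {i // i ≠ j} → ({i // i ≠ j} → ℝ) → E := fun s t => ∑ i ∈ s, t i • a i
  have hf : ∀ s, StronglyMeasurable (f s) := fun s =>
    Finset.stronglyMeasurable_fun_sum _ fun i _ =>
      ((measurable_pi_apply i).stronglyMeasurable).smul_const _
  -- The sum of the remaining terms as a measurable function of their coefficients. Its junk value
  -- where the series diverges is harmless, since the series converges almost surely.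
  let φ : ({i // i ≠ j} → ℝ) → E := fun t => limUnder atTop (f · t)
  have hφ : Measurable φ := (StronglyMeasurable.limUnder (l := atTop) hf).measurable
  let Y : Ω → {i // i ≠ j} → ℝ := fun ω i => ξ i ω
  have hY : Measurable Y := by fun_prop
  have hXw : ∀ᵐ ω ∂Pr, X ω = φ (Y ω) + ξ j ω • a j := by
    filter_upwards [hsum] with ω hω
    have h1 : HasSum (fun i : {i // i ≠ j} => ξ i ω • a i) (X ω - ξ j ω • a j) := by
      have h3 : HasSum (fun i : {i // i ∉ ({j} : Finset ι)} => ξ i ω • a i)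
          (X ω - ξ j ω • a j) := by
        rw [Finset.hasSum_compl_iff (f := fun i => ξ i ω • a i)]
        simpa using hω
      exact (Equiv.subtypeEquivRight (p := fun i => i ≠ j)
        (q := fun i => i ∉ ({j} : Finset ι)) (by simp)).hasSum_iff.2 h3
    have h2 : Tendsto (f · (Y ω)) atTop (𝓝 (X ω - ξ j ω • a j)) := h1
    simp only [φ]
    rw [h2.limUnder_eq]
    abel
  have hIF : IndepFun (fun ω => φ (Y ω)) (ξ j) Pr := by
    have hYj : IndepFun Y (ξ j) Pr := by
      have h := indepFun_subfamilies hξ hind (fun i : {i // i ≠ j} => (i : ι))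
        (fun _ : Unit => j) (by
        rw [Set.disjoint_left]
        rintro _ ⟨i, rfl⟩ ⟨_, hi⟩
        exact i.2 hi.symm)
      exact h.comp (ψ := fun a : Unit → ℝ => a ()) measurable_id (measurable_pi_apply ())
    exact hYj.comp hφ measurable_id
  have hwm : Measurable fun ω => φ (Y ω) := hφ.comp hY
  refine ⟨Pr.map fun ω => φ (Y ω), Measure.isProbabilityMeasure_map hwm.aemeasurable, ?_⟩
  rw [← (indepFun_iff_map_prod_eq_prod_map_map hwm.aemeasurable (hξ j).aemeasurable).1 hIF,
    Measure.map_map (by fun_prop) (by fun_prop)]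
  exact Measure.map_congr hXw

end NoiseSplitting

/-! ### Perturbations of the identity acting on a Lipschitz density on the line. -/

section Shift

theorem surjective_add_of_abs_le {c : ℝ → ℝ} (hc : Continuous c) {M : ℝ} (hM : ∀ r, |c r| ≤ M) :
    Function.Surjective fun r => r + c r := by
  have hcont : Continuous fun r => r + c r := continuous_id.add hc
  refine hcont.surjective ?_ ?_
  · exact tendsto_atTop_add_right_of_le _ (-M) tendsto_id fun r => (abs_le.1 (hM r)).1
  · exact tendsto_atBot_add_right_of_ge _ M tendsto_id fun r => (abs_le.1 (hM r)).2

/-- With `T r = r + c r`, surjectivity gives `A = T (T⁻¹ A)`, and the `(1 + M)`-Lipschitz map `T`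
enlarges one-dimensional Hausdorff measure by at most that factor. Neither an inverse of `T` nor a
derivative of `c` is needed. -/
theorem volume_le_smul_map_add {c : ℝ → ℝ} {M : ℝ≥0} (hc : LipschitzWith M c)
    (hM : ∀ r, |c r| ≤ M) :
    (volume : Measure ℝ) ≤ ((1 + M : ℝ≥0) : ℝ≥0∞) • (volume : Measure ℝ).map fun r => r + c r := by
  have hlip : LipschitzWith (1 + M) fun r => r + c r := LipschitzWith.id.add hc
  refine Measure.le_iff.2 fun A hA => ?_
  rw [Measure.smul_apply, Measure.map_apply hlip.continuous.measurable hA, smul_eq_mul]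
  conv_lhs => rw [← Set.image_preimage_eq A (surjective_add_of_abs_le hc.continuous hM)]
  have := hlip.hausdorffMeasure_image_le (d := 1) zero_le_one ((fun r => r + c r) ⁻¹' A)
  simpa [hausdorffMeasure_real] using this

/-- The image of a Lipschitz density on `[-1, 1]` under a map close to the identity is close to
this density in total variation. -/
theorem lintegral_mul_density_le {ρ : ℝ → ℝ} {L : ℝ≥0} (hρL : LipschitzWith L ρ)
    (hρ1 : ∫⁻ r, ENNReal.ofReal (ρ r) = 1)
    (hρs : ∀ᵐ r, 1 < |r| → ENNReal.ofReal (ρ r) = 0) {c : ℝ → ℝ} {M : ℝ≥0}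
    (hM1 : M ≤ 1) (hc : LipschitzWith M c) (hM : ∀ r, |c r| ≤ M) {g : ℝ → ℝ≥0∞}
    (hg : Measurable g) (hg1 : ∀ r, g r ≤ 1) :
    ∫⁻ r, g r * ENNReal.ofReal (ρ r) ≤
      (∫⁻ r, g (r + c r) * ENNReal.ofReal (ρ r)) + ((1 + 8 * L) * M : ℝ≥0) := by
  have hTm : Measurable fun r => r + c r := measurable_id.add hc.continuous.measurable
  have hρm : Measurable fun r => ENNReal.ofReal (ρ r) := hρL.continuous.measurable.ennreal_ofReal
  let I : Set ℝ := Set.Icc (-1) 1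
  have hI : MeasurableSet I := measurableSet_Icc
  have e1 : ∫⁻ r, g r * ENNReal.ofReal (ρ r) =
      ∫⁻ r, I.indicator (fun r => g r * ENNReal.ofReal (ρ r)) r := by
    refine lintegral_congr_ae ?_
    filter_upwards [hρs] with r hr
    by_cases h : r ∈ I
    · simp [h]
    · have : 1 < |r| := by
        by_contra h'
        exact h (abs_le.1 (not_lt.1 h'))
      simp [h, hr this]
  -- As `|c| ≤ M ≤ 1`, only `r ∈ [-2, 2]` can be moved into `[-1, 1]`. The length `4` of this
  -- interval multiplies the density error `L * M`.
  have hJ : ∀ r, r + c r ∈ I → r ∈ Set.Icc (-2 : ℝ) 2 := by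
    intro r hr
    have h1 := abs_le.1 (hM r)
    have h2 : (M : ℝ) ≤ 1 := by exact_mod_cast hM1
    obtain ⟨h3, h4⟩ := hr
    constructor <;> linarith
  have e2 : ∀ r, I.indicator (fun r => g r * ENNReal.ofReal (ρ r)) (r + c r) ≤
      g (r + c r) * ENNReal.ofReal (ρ r) +
        (Set.Icc (-2 : ℝ) 2).indicator (fun _ => ((L * M : ℝ≥0) : ℝ≥0∞)) r := by
    intro r
    by_cases h : r + c r ∈ I
    · rw [Set.indicator_of_mem h, Set.indicator_of_mem (hJ r h)]
      have h1 : ρ (r + c r) ≤ ρ r + L * M := by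
        have h2 := hρL.dist_le_mul (r + c r) r
        rw [Real.dist_eq, Real.dist_eq, add_sub_cancel_left] at h2
        have h3 : (L : ℝ) * |c r| ≤ L * M := mul_le_mul_of_nonneg_left (hM r) L.2
        linarith [le_abs_self (ρ (r + c r) - ρ r)]
      have h4 : ENNReal.ofReal (ρ (r + c r)) ≤ ENNReal.ofReal (ρ r) + ((L * M : ℝ≥0) : ℝ≥0∞) := by
        refine (ENNReal.ofReal_le_ofReal h1).trans (ENNReal.ofReal_add_le.trans ?_)
        gcongr
        rw [← NNReal.coe_mul, ENNReal.ofReal_coe_nnreal]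
      calc g (r + c r) * ENNReal.ofReal (ρ (r + c r))
          ≤ g (r + c r) * (ENNReal.ofReal (ρ r) + ((L * M : ℝ≥0) : ℝ≥0∞)) := by gcongr
        _ = g (r + c r) * ENNReal.ofReal (ρ r) + g (r + c r) * ((L * M : ℝ≥0) : ℝ≥0∞) :=
          mul_add _ _ _
        _ ≤ g (r + c r) * ENNReal.ofReal (ρ r) + 1 * ((L * M : ℝ≥0) : ℝ≥0∞) := by
          gcongr; exact hg1 _
        _ = _ := by rw [one_mul]
    · rw [Set.indicator_of_notMem h]; exact zero_le
  set A := ∫⁻ r, g (r + c r) * ENNReal.ofReal (ρ r) with hA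
  have hA1 : A ≤ 1 := by
    rw [← hρ1]
    refine lintegral_mono fun r => ?_
    calc _ ≤ 1 * ENNReal.ofReal (ρ r) := by gcongr; exact hg1 _
      _ = _ := one_mul _
  calc ∫⁻ r, g r * ENNReal.ofReal (ρ r)
      = ∫⁻ r, I.indicator (fun r => g r * ENNReal.ofReal (ρ r)) r := e1
    _ ≤ ∫⁻ r, I.indicator (fun r => g r * ENNReal.ofReal (ρ r)) r
          ∂(((1 + M : ℝ≥0) : ℝ≥0∞) • (volume : Measure ℝ).map fun r => r + c r) :=
        lintegral_mono' (volume_le_smul_map_add hc hM) le_rfl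
    _ = ((1 + M : ℝ≥0) : ℝ≥0∞) *
          ∫⁻ r, I.indicator (fun r => g r * ENNReal.ofReal (ρ r)) (r + c r) := by
        rw [lintegral_smul_measure, lintegral_map (by exact (hg.mul hρm).indicator hI) hTm,
          smul_eq_mul]
    _ ≤ ((1 + M : ℝ≥0) : ℝ≥0∞) * (A + ((L * M * 4 : ℝ≥0) : ℝ≥0∞)) := by
        gcongr
        refine (lintegral_mono e2).trans ?_
        rw [lintegral_add_right _ (measurable_const.indicator measurableSet_Icc),
          lintegral_indicator measurableSet_Icc, setLIntegral_const, Real.volume_Icc]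
        refine le_of_eq ?_
        norm_num [hA]
    _ = A + (M * A + ((((1 + M) * (L * M * 4)) : ℝ≥0) : ℝ≥0∞)) := by
        push_cast; ring
    -- The Jacobian factor costs `M * A ≤ M`, and `1 + M ≤ 2` turns `4 * L * M` into `8 * L * M`.
    _ ≤ A + (M * 1 + (((2 * (L * M * 4)) : ℝ≥0) : ℝ≥0∞)) := by
        have : 1 + M ≤ 2 := by rw [← one_add_one_eq_two]; gcongr
        gcongr
    _ = _ := by push_cast; ring

end Shift

/-! ### Noise transformations that change the law only slightly. -/

section AlmostPreserves

/-- `T` changes the measure `ℓ` by at most `ε` in the total variation distance. -/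
structure AlmostPreserves {E : Type*} [MeasurableSpace E] (ℓ : Measure E) (T : E → E) (ε : ℝ≥0) :
    Prop where
  measurable : Measurable T
  lintegral_le : ∀ g : E → ℝ≥0∞, Measurable g → (∀ x, g x ≤ 1) →
    ∫⁻ x, g x ∂ℓ ≤ (∫⁻ x, g (T x) ∂ℓ) + ε

namespace AlmostPreserves

variable {E : Type*} [MeasurableSpace E] {ℓ : Measure E} {T T' : E → E} {ε ε' : ℝ≥0}

theorem id : AlmostPreserves ℓ id 0 := ⟨measurable_id, fun g _ _ => by simp⟩

/-- If `g` is a test function, so is `g ∘ T`; hence the errors add. -/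
theorem comp (h : AlmostPreserves ℓ T ε) (h' : AlmostPreserves ℓ T' ε') :
    AlmostPreserves ℓ (T ∘ T') (ε + ε') := by
  refine ⟨h.measurable.comp h'.measurable, fun g hg hg1 => ?_⟩
  calc ∫⁻ x, g x ∂ℓ ≤ (∫⁻ x, g (T x) ∂ℓ) + ε := h.lintegral_le g hg hg1
    _ ≤ ((∫⁻ x, g (T (T' x)) ∂ℓ) + ε') + ε := by
      gcongr
      exact h'.lintegral_le (fun x => g (T x)) (hg.comp h.measurable) fun x => hg1 _
    _ = _ := by push_cast; simp only [Function.comp]; ring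

theorem mono (h : AlmostPreserves ℓ T ε) (hε : ε ≤ ε') : AlmostPreserves ℓ T ε' :=
  ⟨h.measurable, fun g hg hg1 => (h.lintegral_le g hg hg1).trans (by gcongr)⟩

variable [IsProbabilityMeasure ℓ]

theorem integral_le_of_mem_Icc (h : AlmostPreserves ℓ T ε) {f : E → ℝ} (hf : Measurable f)
    (hf1 : ∀ x, f x ∈ Set.Icc (0 : ℝ) 1) : ∫ x, f x ∂ℓ ≤ (∫ x, f (T x) ∂ℓ) + ε := by
  have h1 := h.lintegral_le (fun x => ENNReal.ofReal (f x)) hf.ennreal_ofReal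
    fun x => by simpa using (hf1 x).2
  have hTf := hf.comp h.measurable
  have hi : Integrable (fun x => f (T x)) ℓ :=
    Integrable.of_bound hTf.aestronglyMeasurable 1 (.of_forall fun x => by
      rw [Real.norm_eq_abs, abs_of_nonneg (hf1 _).1]; exact (hf1 _).2)
  have hi' : Integrable f ℓ :=
    Integrable.of_bound hf.aestronglyMeasurable 1 (.of_forall fun x => by
      rw [Real.norm_eq_abs, abs_of_nonneg (hf1 _).1]; exact (hf1 _).2)
  have hpos : 0 ≤ ∫ x, f (T x) ∂ℓ := integral_nonneg fun x => (hf1 _).1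
  rw [← ofReal_integral_eq_lintegral_ofReal hi' (.of_forall fun x => (hf1 x).1),
    ← ofReal_integral_eq_lintegral_ofReal hi (.of_forall fun x => (hf1 _).1),
    ← ENNReal.ofReal_coe_nnreal, ← ENNReal.ofReal_add hpos ε.coe_nonneg] at h1
  exact (ENNReal.ofReal_le_ofReal_iff (add_nonneg hpos ε.coe_nonneg)).1 h1

/-- The one-sided bound for `[0, 1]`-valued functions is applied to `(f + a) / (2 * a)` and to the
same expression with `-f`, whence the factor `2 * a`. -/
theorem abs_integral_sub_le (h : AlmostPreserves ℓ T ε) {f : E → ℝ} (hf : Measurable f) {a : ℝ}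
    (hfa : ∀ x, |f x| ≤ a) : |∫ x, f x ∂ℓ - ∫ x, f (T x) ∂ℓ| ≤ 2 * a * ε := by
  have hi : ∀ {g : E → ℝ}, Measurable g → (∀ x, |g x| ≤ a) → Integrable g ℓ := fun hg hga =>
    Integrable.of_bound hg.aestronglyMeasurable a (.of_forall hga)
  have key : ∀ g : E → ℝ, Measurable g → (∀ x, |g x| ≤ a) →
      ∫ x, g x ∂ℓ - ∫ x, g (T x) ∂ℓ ≤ 2 * a * ε := by
    intro g hg hga
    obtain ⟨x₀⟩ : Nonempty E := nonempty_of_isProbabilityMeasure ℓ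
    rcases (abs_nonneg (g x₀)).trans (hga x₀) |>.eq_or_lt with rfl | ha
    · have h0 : ∀ x, g x = 0 := fun x => abs_nonpos_iff.1 (hga x)
      simp [h0]
    have h1 := h.integral_le_of_mem_Icc (f := fun x => (g x + a) / (2 * a))
      ((hg.add_const a).div_const _) fun x => by
        have := abs_le.1 (hga x)
        constructor
        · exact div_nonneg (by linarith) (by linarith)
        · rw [div_le_one (by linarith)]; linarith
    rw [integral_div, integral_div, integral_add (hi hg hga) (integrable_const _),
      integral_add (f := fun x => g (T x)) (hi (hg.comp h.measurable) fun x => hga _)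
        (integrable_const _), div_le_iff₀ (by linarith), add_mul, div_mul_cancel₀ _ (by linarith)] at h1
    linarith
  rw [abs_le]
  have h1 := key f hf hfa
  have h2 := key (fun x => - f x) hf.neg fun x => by rw [abs_neg]; exact hfa x
  rw [integral_neg, integral_neg] at h2
  constructor <;> linarith

theorem measureReal_le (h : AlmostPreserves ℓ T ε) {A : Set E} (hA : MeasurableSet A) :
    ℓ.real A ≤ ℓ.real (T ⁻¹' A) + ε := by
  have h1 := h.integral_le_of_mem_Icc (f := A.indicator fun _ => (1 : ℝ))
    (measurable_const.indicator hA) fun x => by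
      by_cases hx : x ∈ A <;> simp [hx]
  have e : (fun x => A.indicator (fun _ => (1 : ℝ)) (T x)) =
      (T ⁻¹' A).indicator fun _ => (1 : ℝ) := rfl
  rwa [e, integral_indicator_const _ hA, integral_indicator_const _ (h.measurable hA), smul_eq_mul,
    smul_eq_mul, mul_one, mul_one] at h1

end AlmostPreserves

/-- Measures with the property that shears in the direction `v` which are close to the identity
change them only slightly. -/
def ShearStable {E : Type*} [NormedAddCommGroup E] [NormedSpace ℝ E] [MeasurableSpace E]
    (ℓ : Measure E) (v : E) : Prop :=
  ∃ C : ℝ≥0, ∀ (M : ℝ≥0) (c : E → ℝ), LipschitzWith M c → (∀ x, |c x| ≤ M) →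
    AlmostPreserves ℓ (fun x => x + c x • v) (C * M)

/-- A shear along `v` preserves each line `w + ℝ v`, so by Fubini the claim reduces to the
one-dimensional estimate for `ρ` on every line, uniformly in `w`. -/
theorem shearStable_map_prod {E : Type*} [NormedAddCommGroup E] [NormedSpace ℝ E]
    [MeasurableSpace E] [BorelSpace E] [SecondCountableTopology E] {ν : Measure E}
    [IsProbabilityMeasure ν] {ρ : ℝ → ℝ} {L : ℝ≥0} (hρL : LipschitzWith L ρ)
    {σ : Measure ℝ} (hσ : σ = volume.withDensity fun r => ENNReal.ofReal (ρ r))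
    [IsProbabilityMeasure σ] (hσ1 : ∀ᵐ r ∂σ, |r| ≤ 1) {b : ℝ} (hb : b ≠ 0) {v : E} (hv : ‖v‖ = 1) :
    ShearStable ((ν.prod σ).map fun p => p.1 + p.2 • b • v) v := by
  have hρm : Measurable fun r => ENNReal.ofReal (ρ r) := hρL.continuous.measurable.ennreal_ofReal
  have hρ1 : ∫⁻ r, ENNReal.ofReal (ρ r) = 1 := by
    have h : σ Set.univ = 1 := measure_univ
    rwa [hσ, withDensity_apply _ MeasurableSet.univ, Measure.restrict_univ] at h
  have hρs : ∀ᵐ r, 1 < |r| → ENNReal.ofReal (ρ r) = 0 := by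
    rw [hσ, ae_withDensity_iff hρm] at hσ1
    filter_upwards [hσ1] with r hr h1
    by_contra h
    exact absurd (hr h) (not_le.2 h1)
  have hcomb : Measurable fun p : E × ℝ => p.1 + p.2 • b • v := by fun_prop
  -- Moving by `c x • v` means shifting the coordinate `r` by `c x / b`. The number `M * κ` bounds
  -- both the size of this shift, at most `M / |b|`, and its Lipschitz constant, at most `M`.
  set κ : ℝ≥0 := max 1 ‖b‖₊⁻¹ with hκ
  refine ⟨(1 + 8 * L) * κ, fun M c hc hM => ?_⟩
  have hcm : Measurable c := hc.continuous.measurable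
  have hTm : Measurable fun x => x + c x • v := by fun_prop
  refine ⟨hTm, fun g hg hg1 => ?_⟩
  have hprob : IsProbabilityMeasure ((ν.prod σ).map fun p : E × ℝ => p.1 + p.2 • b • v) :=
    Measure.isProbabilityMeasure_map hcomb.aemeasurable
  -- For `M * κ > 1` the admitted error is at least `1` and the bound is trivial; otherwise the
  -- shift is small enough for the one-dimensional estimate.
  rcases lt_or_ge 1 (M * κ) with hbig | hsmall
  · calc _ ≤ ∫⁻ _, 1 ∂((ν.prod σ).map fun p : E × ℝ => p.1 + p.2 • b • v) := lintegral_mono hg1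
      _ = 1 := by simp
      _ ≤ (((1 + 8 * L) * κ * M : ℝ≥0) : ℝ≥0∞) := by
        have : 1 ≤ (1 + 8 * L) * κ * M := by
          calc (1 : ℝ≥0) = 1 * 1 := (one_mul 1).symm
            _ ≤ (1 + 8 * L) * (M * κ) := mul_le_mul' le_self_add hbig.le
            _ = _ := by ring
        exact_mod_cast this
      _ ≤ _ := le_add_self
  rw [lintegral_map hg hcomb, lintegral_map (f := fun x => g (x + c x • v)) (hg.comp hTm) hcomb,
    lintegral_prod (fun p : E × ℝ => g (p.1 + p.2 • b • v)) (hg.comp hcomb).aemeasurable,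
    lintegral_prod (fun p : E × ℝ => g (p.1 + p.2 • b • v + c (p.1 + p.2 • b • v) • v))
      ((hg.comp hTm).comp hcomb).aemeasurable]
  have hline : ∀ w : E, ∫⁻ r, g (w + r • b • v) ∂σ ≤
      (∫⁻ r, g (w + r • b • v + c (w + r • b • v) • v) ∂σ) + ((1 + 8 * L) * κ * M : ℝ≥0) := by
    intro w
    have hgw : Measurable fun r : ℝ => g (w + r • b • v) := by fun_prop
    have hgw' : Measurable fun r : ℝ => g (w + r • b • v + c (w + r • b • v) • v) := by fun_prop
    let d : ℝ → ℝ := fun r => c (w + r • b • v) / b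
    have hd : LipschitzWith (M * κ) d := by
      refine LipschitzWith.of_dist_le_mul fun r s => ?_
      have h1 := hc.dist_le_mul (w + r • b • v) (w + s • b • v)
      rw [dist_add_left, dist_eq_norm, dist_eq_norm, ← sub_smul, norm_smul, norm_smul, hv,
        mul_one] at h1
      simp only [d]
      rw [dist_eq_norm, ← sub_div, norm_div, div_le_iff₀ (norm_pos_iff.2 hb)]
      refine h1.trans ?_
      have h2 : (1 : ℝ) ≤ κ := by exact_mod_cast le_max_left _ _
      rw [dist_eq_norm]
      push_cast
      calc (M : ℝ) * (‖r - s‖ * ‖b‖) = M * 1 * ‖r - s‖ * ‖b‖ := by ring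
        _ ≤ _ := by gcongr
    have hd' : ∀ r, |d r| ≤ (M * κ : ℝ≥0) := by
      intro r
      have h2 : ‖b‖⁻¹ ≤ (κ : ℝ) := by
        have : ‖b‖₊⁻¹ ≤ κ := le_max_right _ _
        exact_mod_cast this
      simp only [d]
      rw [abs_div, div_eq_mul_inv]
      push_cast
      exact mul_le_mul (hM _) h2 (by positivity) M.2
    have h1 := lintegral_mul_density_le hρL hρ1 hρs hsmall hd hd' hgw fun r => hg1 _
    have e : ∀ r, w + (r + d r) • b • v = w + r • b • v + c (w + r • b • v) • v := by
      intro r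
      simp only [d]
      rw [add_smul, smul_smul (_ / b), div_mul_cancel₀ _ hb, add_assoc]
    simp only [e] at h1
    rw [hσ, lintegral_withDensity_eq_lintegral_mul _ hρm hgw,
      lintegral_withDensity_eq_lintegral_mul _ hρm hgw']
    simp only [Pi.mul_apply]
    simp only [mul_comm (ENNReal.ofReal _)]
    refine h1.trans_eq ?_
    rw [mul_assoc _ κ, mul_comm κ]
  calc _ ≤ ∫⁻ w, ((∫⁻ r, g (w + r • b • v + c (w + r • b • v) • v) ∂σ) +
        ((1 + 8 * L) * κ * M : ℝ≥0)) ∂ν := lintegral_mono hline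
    _ = _ := by
      rw [lintegral_add_right _ measurable_const, lintegral_const, measure_univ, mul_one]

/-- A composition of shears approximates the map `x ↦ x + ∑ j ∈ J, c j x • e j`. -/
theorem exists_almostPreserves_of_shearStable {ι E : Type*} [NormedAddCommGroup E]
    [NormedSpace ℝ E] [MeasurableSpace E] {ℓ : Measure E} {e : ι → E} (he : ∀ j, ‖e j‖ = 1)
    (hs : ∀ j, ShearStable ℓ (e j)) (J : Finset ι) :
    ∃ C : ℝ≥0, ∀ (M : ℝ≥0) (c : ι → E → ℝ), (∀ j, LipschitzWith M (c j)) →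
      (∀ j x, |c j x| ≤ M) → ∃ Ψ : E → E, AlmostPreserves ℓ Ψ (C * M) ∧
        ∀ x, ‖Ψ x - x‖ ≤ J.card * M ∧
          ‖Ψ x - x - ∑ j ∈ J, c j x • e j‖ ≤ (J.card : ℝ) ^ 2 * (M : ℝ) ^ 2 := by
  classical
  induction J using Finset.induction_on with
  | empty =>
    exact ⟨0, fun M c _ _ => ⟨id, AlmostPreserves.id.mono zero_le, fun x => by simp⟩⟩
  | insert i J hi ih =>
    obtain ⟨C, hC⟩ := ih
    obtain ⟨C', hC'⟩ := hs i
    refine ⟨C' + C, fun M c hc hM => ?_⟩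
    obtain ⟨Ψ, hΨ, hΨx⟩ := hC M c hc hM
    refine ⟨_, ((hC' M (c i) (hc i) (hM i)).comp hΨ).mono (by rw [add_mul]), fun x => ?_⟩
    obtain ⟨h1, h2⟩ := hΨx x
    have hb : ‖c i (Ψ x) • e i‖ ≤ M := by
      rw [norm_smul, he, mul_one]; exact hM i _
    rw [Finset.sum_insert hi, Finset.card_insert_of_notMem hi]
    simp only [Function.comp]
    push_cast
    constructor
    · calc ‖Ψ x + c i (Ψ x) • e i - x‖ = ‖(Ψ x - x) + c i (Ψ x) • e i‖ := by congr 1; abel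
        _ ≤ _ := norm_add_le _ _
        _ ≤ J.card * M + M := add_le_add h1 hb
        _ = _ := by ring
    -- The new shear reads its coefficient at `Ψ x` instead of `x`. As `c i` is `M`-Lipschitz and
    -- `Ψ` moves points by at most `|J| * M`, this costs `|J| * M ^ 2`, and `|J| ^ 2 + |J| ≤ (|J| +
    -- 1) ^ 2`.
    · have hd : ‖c i (Ψ x) • e i - c i x • e i‖ ≤ M * (J.card * M) := by
        rw [← sub_smul, norm_smul, he, mul_one, ← dist_eq_norm]
        refine ((hc i).dist_le_mul _ _).trans ?_
        rw [dist_eq_norm]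
        gcongr
      calc ‖Ψ x + c i (Ψ x) • e i - x - (c i x • e i + ∑ j ∈ J, c j x • e j)‖
          = ‖(Ψ x - x - ∑ j ∈ J, c j x • e j) + (c i (Ψ x) • e i - c i x • e i)‖ := by
            congr 1; abel
        _ ≤ _ := norm_add_le _ _
        _ ≤ (J.card : ℝ) ^ 2 * (M : ℝ) ^ 2 + M * (J.card * M) := add_le_add h2 hd
        _ ≤ _ := by
          have : (0 : ℝ) ≤ (M : ℝ) ^ 2 * (J.card + 1) := by positivity
          nlinarith

end AlmostPreserves

/-! ### Compactness of the Hilbert cube. -/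

section Cube

variable {ι E : Type*} [NormedAddCommGroup E] [InnerProductSpace ℝ E]

/-- The Hilbert cube with sides `|b j|`. -/
def cube (e : HilbertBasis ι ℝ E) (b : ι → ℝ) : Set E := {x | ∀ j, |⟪e j, x⟫| ≤ |b j|}

theorem isClosed_cube (e : HilbertBasis ι ℝ E) (b : ι → ℝ) : IsClosed (cube e b) := by
  simp only [cube, Set.ofPred_forall]
  exact isClosed_iInter fun j => isClosed_le (by fun_prop) continuous_const

theorem norm_sq_le_of_inner_sq_le (e : HilbertBasis ι ℝ E) {y : E} {a : ι → ℝ} {A : ℝ}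
    (ha : HasSum a A) (h : ∀ j, ⟪e j, y⟫ ^ 2 ≤ a j) : ‖y‖ ^ 2 ≤ A := by
  have h1 := e.hasSum_inner_mul_inner y y
  rw [real_inner_self_eq_norm_sq] at h1
  refine hasSum_le (fun j => ?_) h1 ha
  rw [real_inner_comm (e j) y, ← sq]
  exact h j

theorem inner_eq_of_hasSum (e : HilbertBasis ι ℝ E) {t : ι → ℝ} {x : E}
    (h : HasSum (fun j => t j • e j) x) (i : ι) : ⟪e i, x⟫ = t i := by
  classical
  have h1 := (innerSL ℝ (e i)).hasSum h
  simp only [innerSL_apply_apply, inner_smul_right, orthonormal_iff_ite.1 e.orthonormal] at h1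
  refine h1.unique ?_
  have h2 := hasSum_single (f := fun j => t j * if i = j then (1 : ℝ) else 0) i
    fun j hj => by simp [hj.symm]
  simpa using h2

theorem exists_finset_hasSum_lt {b : ι → ℝ} (hb : Summable fun j => b j ^ 2) {ε : ℝ} (hε : 0 < ε) :
    ∃ (J : Finset ι) (A : ℝ), A < ε ∧
      HasSum (fun j => (J : Set ι)ᶜ.indicator (fun j => b j ^ 2) j) A := by
  obtain ⟨J, hJ⟩ := (((tendsto_order.1 hb.hasSum).1 ((∑' j, b j ^ 2) - ε) (by linarith))).exists
  refine ⟨J, (∑' j, b j ^ 2) - ∑ j ∈ J, b j ^ 2, by linarith, ?_⟩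
  have h1 : HasSum ((J : Set ι).indicator fun j => b j ^ 2) (∑ j ∈ J, b j ^ 2) := by
    have : HasSum ((J : Set ι).indicator fun j => b j ^ 2)
        (∑ j ∈ J, (J : Set ι).indicator (fun j => b j ^ 2) j) :=
      hasSum_sum_of_ne_finset_zero fun j hj => by simp [hj]
    rwa [Finset.sum_congr rfl fun j hj => Set.indicator_of_mem (Finset.mem_coe.2 hj) _] at this
  refine (hb.hasSum.sub h1).congr_fun ?_
  intro j
  by_cases hj : j ∈ J <;> simp [hj]

/-- The coordinates outside a large finite set `J` contribute uniformly little, so a finite net of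
the compact finite-dimensional box over `J` is a net of the cube. -/
theorem isCompact_cube [CompleteSpace E] (e : HilbertBasis ι ℝ E) {b : ι → ℝ}
    (hb : Summable fun j => b j ^ 2) : IsCompact (cube e b) := by
  classical
  refine isCompact_iff_totallyBounded_isComplete.2 ⟨?_, (isClosed_cube e b).isComplete⟩
  rw [Metric.totallyBounded_iff]
  intro ε hε
  obtain ⟨J, A, hA, hJA⟩ := exists_finset_hasSum_lt hb (ε := (ε / 2) ^ 2) (by positivity)
  have hcomp : IsCompact ((fun t : ι → ℝ => ∑ j ∈ J, t j • e j) ''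
      Set.pi Set.univ fun j => Set.Icc (-|b j|) |b j|) :=
    (isCompact_univ_pi fun j => isCompact_Icc).image (by fun_prop)
  obtain ⟨t, ht, hcov⟩ := Metric.totallyBounded_iff.1 hcomp.totallyBounded (ε / 2) (by positivity)
  refine ⟨t, ht, fun x hx => ?_⟩
  set z := ∑ j ∈ J, ⟪e j, x⟫ • e j with hz
  have hzmem : z ∈ (fun t : ι → ℝ => ∑ j ∈ J, t j • e j) ''
      Set.pi Set.univ fun j => Set.Icc (-|b j|) |b j| :=
    ⟨fun j => ⟪e j, x⟫, fun j _ => abs_le.1 (hx j), rfl⟩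
  obtain ⟨y, hy, hzy⟩ := Set.mem_iUnion₂.1 (hcov hzmem)
  have hxz : ‖x - z‖ ^ 2 ≤ A := by
    refine norm_sq_le_of_inner_sq_le e hJA fun j => ?_
    have h1 : ⟪e j, z⟫ = if j ∈ J then ⟪e j, x⟫ else 0 := by
      rw [hz, inner_sum]
      simp only [inner_smul_right, orthonormal_iff_ite.1 e.orthonormal]
      simp
    rw [inner_sub_right, h1]
    by_cases hj : j ∈ J
    · simp [hj]
    · simpa [hj] using sq_le_sq.2 (hx j)
  have hxz' : ‖x - z‖ < ε / 2 := by
    refine lt_of_pow_lt_pow_left₀ 2 (by positivity) (by linarith)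
  refine Set.mem_iUnion₂.2 ⟨y, hy, ?_⟩
  rw [Metric.mem_ball] at hzy ⊢
  calc dist x y ≤ dist x z + dist z y := dist_triangle _ _ _
    _ < ε := by rw [dist_eq_norm x z]; linarith

end Cube

/-! ### Consequences of the noise decomposition for the law and its support. -/

section Noise

variable {ι Ω E : Type*} [MeasurableSpace Ω] {Pr : Measure Ω}
  [NormedAddCommGroup E] [InnerProductSpace ℝ E]

theorem ae_mem_cube [Countable ι] {e : HilbertBasis ι ℝ E} {b : ι → ℝ} {ξ : ι → Ω → ℝ} {X : Ω → E}
    (hsum : ∀ᵐ ω ∂Pr, HasSum (fun j => (b j * ξ j ω) • e j) (X ω))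
    (hξ : ∀ j, ∀ᵐ ω ∂Pr, |ξ j ω| ≤ 1) : ∀ᵐ ω ∂Pr, X ω ∈ cube e b := by
  filter_upwards [hsum, ae_all_iff.2 hξ] with ω h1 h2 j
  rw [inner_eq_of_hasSum e h1 j, abs_mul]
  exact mul_le_of_le_one_right (abs_nonneg _) (h2 j)

theorem map_apply_Ioo_pos {ρ : ℝ → ℝ} (hρ : Continuous ρ) (h0 : 0 < ρ 0) {s : ℝ} (hs : 0 < s) :
    volume.withDensity (fun r => ENNReal.ofReal (ρ r)) (Set.Ioo (-s) s) ≠ 0 := by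
  rw [Ne, withDensity_apply_eq_zero hρ.measurable.ennreal_ofReal]
  have hopen : IsOpen ({r | 0 < ρ r} ∩ Set.Ioo (-s) s) :=
    (isOpen_lt continuous_const hρ).inter isOpen_Ioo
  have hpos := hopen.measure_pos volume ⟨0, h0, by simpa using hs⟩
  refine (hpos.trans_le (measure_mono ?_)).ne'
  intro r hr
  exact ⟨by simpa using hr.1, hr.2⟩

/-- If the finitely many coefficients with index in `J` are below `s`, then `‖X‖ ^ 2` is at most `s
^ 2 * B` plus the small tail. By independence this event has a product of nonzero probabilities. -/
theorem zero_mem_support_map [Countable ι] [MeasurableSpace E] [BorelSpace E]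
    {e : HilbertBasis ι ℝ E} {b : ι → ℝ}
    {ξ : ι → Ω → ℝ} {X : Ω → E} (hX : Measurable X)
    (hb : Summable fun j => b j ^ 2)
    (hsum : ∀ᵐ ω ∂Pr, HasSum (fun j => (b j * ξ j ω) • e j) (X ω))
    (hξ : ∀ j, ∀ᵐ ω ∂Pr, |ξ j ω| ≤ 1) (hξm : ∀ j, Measurable (ξ j)) (hind : iIndepFun ξ Pr)
    (hpos : ∀ j s, 0 < s → Pr.map (ξ j) (Set.Ioo (-s) s) ≠ 0) :
    (0 : E) ∈ (Pr.map X).support := by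
  rw [Measure.mem_support_iff_forall]
  intro U hU
  obtain ⟨ε, hε, hεU⟩ := Metric.mem_nhds_iff.1 hU
  refine lt_of_lt_of_le ?_ (measure_mono hεU)
  rw [Measure.map_apply hX Metric.isOpen_ball.measurableSet]
  obtain ⟨J, A, hA, hJA⟩ := exists_finset_hasSum_lt hb (ε := ε ^ 2 / 2) (by positivity)
  set B := ∑' j, b j ^ 2
  have hB0 : 0 ≤ B := tsum_nonneg fun j => sq_nonneg _
  obtain ⟨s, hs0, hs⟩ : ∃ s : ℝ, 0 < s ∧ s ^ 2 * B < ε ^ 2 / 2 := by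
    refine ⟨Real.sqrt (ε ^ 2 / 4 / (B + 1)), by positivity, ?_⟩
    rw [Real.sq_sqrt (by positivity), div_mul_eq_mul_div, div_lt_iff₀ (by positivity)]
    nlinarith [sq_nonneg ε, mul_nonneg (sq_nonneg ε) hB0, pow_pos hε 2]
  have hsub : (⋂ j ∈ J, ξ j ⁻¹' Set.Ioo (-s) s : Set Ω) ≤ᵐ[Pr] X ⁻¹' Metric.ball 0 ε := by
    filter_upwards [hsum, ae_all_iff.2 hξ] with ω h1 h2 hω
    have hω' : ∀ j ∈ J, |ξ j ω| ≤ s := fun j hj =>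
      (abs_lt.2 (Set.mem_iInter₂.1 hω j hj)).le
    have hle : ‖X ω‖ ^ 2 ≤ s ^ 2 * B + A := by
      refine norm_sq_le_of_inner_sq_le e ((hb.hasSum.mul_left (s ^ 2)).add hJA) fun j => ?_
      rw [inner_eq_of_hasSum e h1 j, mul_pow]
      by_cases hj : j ∈ J
      · have := sq_le_sq.2 (show |ξ j ω| ≤ |s| from (hω' j hj).trans (le_abs_self s))
        simp only [Set.mem_compl_iff, Finset.mem_coe, hj, not_true_eq_false,
          not_false_eq_true, Set.indicator_of_notMem, add_zero]
        nlinarith [sq_nonneg (b j)]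
      · have h3 : ξ j ω ^ 2 ≤ 1 := by
          simpa using sq_le_sq.2 (show |ξ j ω| ≤ |(1 : ℝ)| by simpa using h2 j)
        simp only [Set.mem_compl_iff, Finset.mem_coe, hj, not_false_eq_true,
          Set.indicator_of_mem]
        nlinarith [sq_nonneg (b j), mul_nonneg (sq_nonneg s) (sq_nonneg (b j))]
    change X ω ∈ Metric.ball 0 ε
    rw [mem_ball_zero_iff]
    exact lt_of_pow_lt_pow_left₀ 2 hε.le (by linarith)
  refine lt_of_lt_of_le ?_ (measure_mono_ae hsub)
  rw [hind.measure_inter_preimage_eq_mul J (sets := fun _ => Set.Ioo (-s) s)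
    fun j _ => measurableSet_Ioo]
  refine pos_iff_ne_zero.2 (Finset.prod_ne_zero_iff.2 fun j _ => ?_)
  rw [← Measure.map_apply (hξm j) measurableSet_Ioo]
  exact hpos j s hs0

/-- The properties of the noise used in the proof of mixing. -/
theorem Decomposable.noise_properties [IsProbabilityMeasure Pr] [Countable ι]
    [CompleteSpace E] [MeasurableSpace E] [BorelSpace E] [TopologicalSpace.SeparableSpace E]
    {η : ℕ → Ω → E} {ℓ : Measure E} (hη : IsIIDWithLaw Pr η ℓ) (h : Decomposable ι Pr η) :
    ∃ e : HilbertBasis ι ℝ E, (∀ j, ShearStable ℓ (e j)) ∧ IsCompact ℓ.support ∧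
      (0 : E) ∈ ℓ.support := by
  have : SecondCountableTopology E := UniformSpace.secondCountable_of_separable E
  obtain ⟨e, b, ξ, ρ, hsum, hb, hb2, hξm, hind, hξ1, hρ, hlaw, hlip, hρ0⟩ := h
  have hind0 : iIndepFun (fun j => ξ j 0) Pr :=
    hind.precomp (g := fun j : ι => (j, 0)) fun i j hij => (Prod.ext_iff.1 hij).1
  refine ⟨e, fun j => ?_, ?_, ?_⟩
  · obtain ⟨L, hL⟩ := hlip j
    obtain ⟨ν, hν, hmap⟩ := exists_map_eq_map_prod_add_smul (Pr := Pr) (a := fun j => b j • e j)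
      (ξ := fun j => ξ j 0) (X := η 0)
      ((hsum 0).mono fun ω hω => by simpa only [smul_smul, mul_comm] using hω)
      (fun j => hξm j 0) hind0 j
    have hp : IsProbabilityMeasure (Pr.map (ξ j 0)) :=
      Measure.isProbabilityMeasure_map (hξm j 0).aemeasurable
    rw [← hη.law 0, hmap]
    refine shearStable_map_prod hL (hlaw j 0) ?_ (hb j) (e.orthonormal.norm_eq_one j)
    exact (ae_map_iff (hξm j 0).aemeasurable
      (measurableSet_le (by fun_prop) measurable_const)).2 (hξ1 j 0)
  · refine (isCompact_cube e hb2).of_isClosed_subset Measure.isClosed_support ?_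
    refine Measure.support_subset_of_isClosed (isClosed_cube e b) ?_
    rw [← hη.law 0]
    exact (ae_map_iff (hη.measurable 0).aemeasurable (isClosed_cube e b).measurableSet).2
      (ae_mem_cube (hsum 0) fun j => hξ1 j 0)
  · rw [← hη.law 0]
    refine zero_mem_support_map (hη.measurable 0) hb2 (hsum 0) (fun j => hξ1 j 0)
      (fun j => hξm j 0) hind0 fun j s hs => ?_
    obtain ⟨L, hL⟩ := hlip j
    rw [hlaw j 0]
    exact map_apply_Ioo_pos hL.continuous ((hρ j 0).lt_of_ne' (hρ0 j)) hs

end Noise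

/-! ### Approximate solution of the linearized control problem. -/

section ApproximateInverse

variable {ι H E : Type*} [NormedAddCommGroup H] [InnerProductSpace ℝ H]
  [NormedAddCommGroup E] [InnerProductSpace ℝ E]

theorem exists_finset_inner_eq_zero (e : HilbertBasis ι ℝ E) {x : E}
    (hx : x ∈ Submodule.span ℝ (Set.range e)) : ∃ J : Finset ι, ∀ j ∉ J, ⟪e j, x⟫ = 0 := by
  classical
  induction hx using Submodule.span_induction with
  | mem x hx =>
    obtain ⟨i, rfl⟩ := hx
    exact ⟨{i}, fun j hj => e.orthonormal.2 (by simpa using hj)⟩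
  | zero => exact ⟨∅, fun j _ => inner_zero_right _⟩
  | add x y _ _ hx hy =>
    obtain ⟨J, hJ⟩ := hx
    obtain ⟨J', hJ'⟩ := hy
    refine ⟨J ∪ J', fun j hj => ?_⟩
    rw [Finset.mem_union, not_or] at hj
    rw [inner_add_right, hJ j hj.1, hJ' j hj.2, add_zero]
  | smul a x _ hx =>
    obtain ⟨J, hJ⟩ := hx
    exact ⟨J, fun j hj => by rw [inner_smul_right, hJ j hj, mul_zero]⟩

theorem eq_sum_inner_smul (e : HilbertBasis ι ℝ E) {x : E} {J : Finset ι}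
    (hJ : ∀ j ∉ J, ⟪e j, x⟫ = 0) : x = ∑ j ∈ J, ⟪e j, x⟫ • e j := by
  have h1 := e.hasSum_repr x
  simp only [HilbertBasis.repr_apply_apply] at h1
  exact h1.unique (hasSum_sum_of_ne_finset_zero fun j hj => by rw [hJ j hj, zero_smul])

/-- A compact operator on a Hilbert space is uniformly close to an operator of finite rank obtained
by orthogonal projection. -/
theorem exists_orthonormal_norm_sub_sum_le {D : H →L[ℝ] H} (hD : IsCompactOperator D) {ε : ℝ}
    (hε : 0 < ε) : ∃ (n : ℕ) (w : Fin n → H), (∀ i, ‖w i‖ = 1) ∧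
      ∀ h, ‖D h - ∑ i, ⟪w i, D h⟫ • w i‖ ≤ ε * ‖h‖ := by
  have htb : TotallyBounded (D '' Metric.closedBall 0 1) :=
    (hD.isCompact_closure_image_closedBall (f := (D : H →ₗ[ℝ] H)) 1).totallyBounded.subset
      subset_closure
  obtain ⟨t, ht, hcov⟩ := Metric.totallyBounded_iff.1 htb ε hε
  let W : Submodule ℝ H := Submodule.span ℝ t
  have hW : FiniteDimensional ℝ W := FiniteDimensional.span_of_finite ℝ ht
  let B := stdOrthonormalBasis ℝ W
  have hproj : ∀ y, W.starProjection y = ∑ i, ⟪(B i : H), y⟫ • (B i : H) := by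
    intro y
    rw [Submodule.starProjection_apply, ← B.sum_repr' (W.orthogonalProjectionOnto y)]
    simp only [Submodule.coe_sum, Submodule.coe_smul]
    refine Finset.sum_congr rfl fun i _ => ?_
    rw [Submodule.inner_orthogonalProjectionOnto_eq_of_mem_left]
  refine ⟨_, fun i => (B i : H), fun i => B.orthonormal.1 i, fun h => ?_⟩
  -- The net point near `D h` lies in `W`, and the orthogonal projection is at least as close to `D
  -- h` as any point of `W`.
  have hball : ∀ h : H, ‖h‖ ≤ 1 → ‖D h - W.starProjection (D h)‖ ≤ ε := by
    intro h hh
    obtain ⟨y, hy, hhy⟩ := Set.mem_iUnion₂.1 (hcov ⟨h, by simpa using hh, rfl⟩)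
    rw [Submodule.starProjection_minimal]
    refine (ciInf_le ⟨0, ?_⟩ (⟨y, Submodule.subset_span hy⟩ : W)).trans ?_
    · rintro _ ⟨x, rfl⟩
      exact norm_nonneg _
    · rw [← dist_eq_norm]
      exact (Metric.mem_ball.1 hhy).le
  rw [← hproj]
  rcases eq_or_ne h 0 with rfl | h0
  · simp
  have h1 := hball (‖h‖⁻¹ • h) (by
    rw [norm_smul, norm_inv, norm_norm, inv_mul_cancel₀ (norm_ne_zero_iff.2 h0)])
  rw [map_smul, map_smul, ← smul_sub, norm_smul, norm_inv, norm_norm, inv_mul_le_iff₀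
    (norm_pos_iff.2 h0)] at h1
  linarith

/-- Up to `ε / 2`, the operator `D` takes values in the span of finitely many unit vectors `w i`.
Density of `A (span e)` provides `x i` in the span of the basis with `A (x i) ≈ -w i`, and `R h = ∑
⟪w i, D h⟫ • x i` nearly cancels `D`. -/
theorem exists_finiteRank_norm_add_le (e : HilbertBasis ι ℝ E) {D : H →L[ℝ] H}
    (hD : IsCompactOperator D) {A : E →L[ℝ] H} (hA : DenseRange A) {ε : ℝ} (hε : 0 < ε) :
    ∃ (R : H →L[ℝ] E) (J : Finset ι), (∀ h, ∀ j ∉ J, ⟪e j, R h⟫ = 0) ∧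
      ∀ h, ‖D h + A (R h)‖ ≤ ε * ‖h‖ := by
  classical
  obtain ⟨n, w, hw, hDw⟩ := exists_orthonormal_norm_sub_sum_le hD (half_pos hε)
  have hdense : Dense (A '' (Submodule.span ℝ (Set.range e) : Set E)) := by
    refine hA.dense_image A.continuous ?_
    have := e.dense_span
    rw [Submodule.dense_iff_topologicalClosure_eq_top]
    exact this
  set τ : ℝ := ε / 2 / (n * ‖D‖ + 1) with hτ
  have hτ0 : 0 < τ := by positivity
  have hx : ∀ i, ∃ x ∈ Submodule.span ℝ (Set.range e), ‖w i + A x‖ ≤ τ := by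
    intro i
    obtain ⟨_, ⟨x, hx, rfl⟩, hxi⟩ := hdense.exists_dist_lt (-w i) hτ0
    refine ⟨x, hx, ?_⟩
    rw [dist_comm, dist_eq_norm, sub_neg_eq_add, add_comm] at hxi
    exact hxi.le
  choose x hxs hxw using hx
  choose J hJ using fun i => exists_finset_inner_eq_zero e (hxs i)
  let R : H →L[ℝ] E := ∑ i, ((innerSL ℝ (w i)).comp D).smulRight (x i)
  have hR : ∀ h, R h = ∑ i, ⟪w i, D h⟫ • x i := by
    intro h
    simp [R]
  refine ⟨R, Finset.univ.biUnion J, fun h j hj => ?_, fun h => ?_⟩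
  · rw [hR, inner_sum]
    refine Finset.sum_eq_zero fun i _ => ?_
    rw [inner_smul_right, hJ i j fun hji => hj (Finset.mem_biUnion.2 ⟨i, Finset.mem_univ i, hji⟩),
      mul_zero]
  · have hsplit : D h + A (R h) =
        (D h - ∑ i, ⟪w i, D h⟫ • w i) + ∑ i, ⟪w i, D h⟫ • (w i + A (x i)) := by
      rw [hR, map_sum]
      simp only [map_smul, smul_add, Finset.sum_add_distrib]
      abel
    rw [hsplit]
    refine (norm_add_le _ _).trans ?_
    have h2 : ‖∑ i, ⟪w i, D h⟫ • (w i + A (x i))‖ ≤ ε / 2 * ‖h‖ := by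
      calc _ ≤ ∑ i : Fin n, ‖⟪w i, D h⟫ • (w i + A (x i))‖ := norm_sum_le _ _
        _ ≤ ∑ i : Fin n, (‖D‖ * ‖h‖) * τ := by
          refine Finset.sum_le_sum fun i _ => ?_
          rw [norm_smul]
          refine mul_le_mul ?_ (hxw i) (norm_nonneg _) (by positivity)
          refine (norm_inner_le_norm _ _).trans ?_
          rw [hw, one_mul]
          exact D.le_opNorm h
        _ = n * ‖D‖ * τ * ‖h‖ := by
          rw [Finset.sum_const, Finset.card_univ, Fintype.card_fin, nsmul_eq_mul]; ring
        _ ≤ (n * ‖D‖ + 1) * τ * ‖h‖ := by gcongr; linarith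
        _ = _ := by rw [hτ]; field_simp
    linarith [hDw h]

/-- The operators provided by `exists_finiteRank_norm_add_le` may be glued together to a Lipschitz
family over a compact set. -/
theorem exists_lipschitz_approximate_inverse (e : HilbertBasis ι ℝ E)
    {P : H × E → (H × E →L[ℝ] H)} (hP : Continuous P) {Z : Set (H × E)} (hZ : IsCompact Z) {ε : ℝ}
    (hε : 0 < ε) (hloc : ∀ z ∈ Z, ∃ (R : H →L[ℝ] E) (J : Finset ι),
      (∀ h, ∀ j ∉ J, ⟪e j, R h⟫ = 0) ∧ ∀ h, ‖P z (h, R h)‖ ≤ ε / 2 * ‖h‖) :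
    ∃ (G : H × E → H →L[ℝ] E) (J : Finset ι) (C : ℝ≥0), (∀ z h, ∀ j ∉ J, ⟪e j, G z h⟫ = 0) ∧
      (∀ z, ‖G z‖ ≤ C) ∧ LipschitzWith C G ∧ ∀ z ∈ Z, ∀ h, ‖P z (h, G z h)‖ ≤ ε * ‖h‖ := by
  classical
  -- By continuity of `P`, the operator found at `z` still works near `z`, with `ε` in place of `ε /
  -- 2`. The values chosen for `z ∉ Z` only make the choice total.
  have hloc' : ∀ z : H × E, ∃ (R : H →L[ℝ] E) (J : Finset ι) (r : ℝ), 0 < r ∧ (z ∈ Z →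
      (∀ h, ∀ j ∉ J, ⟪e j, R h⟫ = 0) ∧
        ∀ y, dist y z < r → ∀ h, ‖P y (h, R h)‖ ≤ ε * ‖h‖) := by
    intro z
    by_cases hz : z ∈ Z
    swap
    · exact ⟨0, ∅, 1, one_pos, fun h => absurd h hz⟩
    obtain ⟨R, J, hJ, hR⟩ := hloc z hz
    have hpos : 0 < ε / 2 / (1 + ‖R‖) := by positivity
    obtain ⟨r, hr, hrP⟩ := Metric.eventually_nhds_iff.1
      ((hP.tendsto z).eventually (Metric.ball_mem_nhds (P z) hpos))
    refine ⟨R, J, r, hr, fun _ => ⟨hJ, fun y hy h => ?_⟩⟩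
    have h1 : ‖(h, R h)‖ ≤ (1 + ‖R‖) * ‖h‖ := by
      rw [Prod.norm_def]
      refine max_le ?_ ?_
      · nlinarith [norm_nonneg R, norm_nonneg h]
      · exact (R.le_opNorm h).trans (by nlinarith [norm_nonneg h])
    calc ‖P y (h, R h)‖ = ‖P z (h, R h) + (P y - P z) (h, R h)‖ := by
          rw [sub_apply]; congr 1; abel
      _ ≤ ‖P z (h, R h)‖ + ‖(P y - P z) (h, R h)‖ := norm_add_le _ _
      _ ≤ ε / 2 * ‖h‖ + ε / 2 / (1 + ‖R‖) * ((1 + ‖R‖) * ‖h‖) := by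
          refine add_le_add (hR h) ((ContinuousLinearMap.le_opNorm _ _).trans ?_)
          have : ‖P y - P z‖ < ε / 2 / (1 + ‖R‖) :=
            (dist_eq_norm (P y) (P z)).symm.trans_lt (hrP hy)
          gcongr
      _ = ε * ‖h‖ := by field_simp; ring
  choose R J r hr hRJ using hloc'
  obtain ⟨t, htZ, hcov⟩ := hZ.elim_nhds_subcover (fun z => Metric.ball z (r z))
    fun z _ => Metric.ball_mem_nhds z (hr z)
  let ψ : H × E → H × E → ℝ := fun z y => max (r z - dist y z) 0
  have hψ0 : ∀ z y, 0 ≤ ψ z y := fun z y => le_max_right _ _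
  have hψl : ∀ z y y', |ψ z y - ψ z y'| ≤ dist y y' := by
    intro z y y'
    simp only [ψ]
    refine (abs_max_sub_max_le_abs _ _ _).trans ?_
    rw [sub_sub_sub_cancel_left, dist_comm y y']
    exact abs_dist_sub_le y' y z
  let tot : H × E → ℝ := fun y => ∑ z ∈ t, ψ z y
  have htot : Continuous tot := by fun_prop
  obtain ⟨c, hc0, hc⟩ := hZ.exists_forall_le' (f := tot) (a := 0) htot.continuousOn (by
    intro y hy
    obtain ⟨z, hz, hyz⟩ := Set.mem_iUnion₂.1 (hcov hy)
    refine Finset.sum_pos' (fun z _ => hψ0 z y) ⟨z, hz, ?_⟩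
    exact lt_max_of_lt_left (sub_pos.2 (Metric.mem_ball.1 hyz)))
  -- On `Z` one has `tot ≥ c`, so there `N = tot` and the quotients `ψ / N` sum to `1`. Off `Z` the
  -- cutoff keeps the denominator away from zero, which makes the quotients Lipschitz on the whole
  -- space.
  let N : H × E → ℝ := fun y => max (tot y) c
  have hNc : ∀ y, c ≤ N y := fun y => le_max_right _ _
  have hN0 : ∀ y, 0 < N y := fun y => hc0.trans_le (hNc y)
  have hNl : ∀ y y', |N y - N y'| ≤ t.card * dist y y' := by
    intro y y'
    simp only [N]
    refine (abs_max_sub_max_le_abs _ _ _).trans ?_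
    simp only [tot]
    rw [← Finset.sum_sub_distrib]
    refine (Finset.abs_sum_le_sum_abs _ _).trans
      ((Finset.sum_le_sum fun z _ => hψl z y y').trans ?_)
    rw [Finset.sum_const, nsmul_eq_mul]
  have hψN : ∀ z ∈ t, ∀ y, ψ z y ≤ N y := fun z hz y =>
    (Finset.single_le_sum (f := fun z => ψ z y) (fun z _ => hψ0 z y) hz).trans (le_max_left _ _)
  let φ : H × E → H × E → ℝ := fun z y => ψ z y / N y
  have hφ0 : ∀ z y, 0 ≤ φ z y := fun z y => div_nonneg (hψ0 z y) (hN0 y).le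
  have hφ1 : ∀ z ∈ t, ∀ y, φ z y ≤ 1 := fun z hz y => (div_le_one (hN0 y)).2 (hψN z hz y)
  have hφl : ∀ z ∈ t, ∀ y y', |φ z y - φ z y'| ≤ (1 + t.card) / c * dist y y' := by
    intro z hz y y'
    have h1 : φ z y - φ z y' = (ψ z y - ψ z y') / N y + φ z y' * ((N y' - N y) / N y) := by
      simp only [φ]
      have := (hN0 y).ne'
      have := (hN0 y').ne'
      field_simp
      ring
    rw [h1]
    refine (abs_add_le _ _).trans ?_
    rw [abs_mul, abs_of_nonneg (hφ0 z y'), abs_div, abs_div, abs_of_pos (hN0 y)]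
    calc |ψ z y - ψ z y'| / N y + φ z y' * (|N y' - N y| / N y)
        ≤ dist y y' / c + 1 * ((t.card * dist y y') / c) := by
          refine add_le_add ?_ (mul_le_mul (hφ1 z hz y') ?_ ?_ zero_le_one)
          · exact div_le_div₀ dist_nonneg (hψl z y y') hc0 (hNc y)
          · refine div_le_div₀ (by positivity) ?_ hc0 (hNc y)
            rw [dist_comm]
            exact hNl y' y
          · exact div_nonneg (abs_nonneg _) (hN0 y).le
      _ = _ := by ring
  let G : H × E → H →L[ℝ] E := fun y => ∑ z ∈ t, φ z y • R z
  have hG : ∀ y h, G y h = ∑ z ∈ t, φ z y • R z h := fun y h => by simp [G]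
  let B : ℝ := ∑ z ∈ t, ‖R z‖
  have hB : 0 ≤ B := Finset.sum_nonneg fun z _ => norm_nonneg _
  have hq : 0 ≤ (1 + t.card) / c := by positivity
  refine ⟨G, t.biUnion J, ⟨B * (1 + (1 + t.card) / c), by positivity⟩, ?_, ?_, ?_, ?_⟩
  · intro y h j hj
    rw [hG, inner_sum]
    refine Finset.sum_eq_zero fun z hz => ?_
    rw [inner_smul_right, (hRJ z (htZ z hz)).1 h j fun hji =>
      hj (Finset.mem_biUnion.2 ⟨z, hz, hji⟩),
      mul_zero]
  · intro y
    calc ‖G y‖ ≤ ∑ z ∈ t, ‖φ z y • R z‖ := norm_sum_le _ _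
      _ ≤ ∑ z ∈ t, ‖R z‖ := by
        refine Finset.sum_le_sum fun z hz => ?_
        rw [norm_smul, Real.norm_of_nonneg (hφ0 z y)]
        exact mul_le_of_le_one_left (norm_nonneg _) (hφ1 z hz y)
      _ ≤ B * (1 + (1 + t.card) / c) := by nlinarith
  · refine LipschitzWith.of_dist_le_mul fun y y' => ?_
    rw [dist_eq_norm]
    simp only [G]
    rw [← Finset.sum_sub_distrib]
    calc _ ≤ ∑ z ∈ t, ‖φ z y • R z - φ z y' • R z‖ := norm_sum_le _ _
      _ ≤ ∑ z ∈ t, ‖R z‖ * ((1 + t.card) / c * dist y y') := by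
        refine Finset.sum_le_sum fun z hz => ?_
        rw [← sub_smul, norm_smul, mul_comm]
        exact mul_le_mul_of_nonneg_left (hφl z hz y y') (norm_nonneg _)
      _ = B * ((1 + t.card) / c) * dist y y' := by rw [← Finset.sum_mul, mul_assoc]
      _ ≤ _ := by
        refine mul_le_mul_of_nonneg_right ?_ dist_nonneg
        change B * ((1 + t.card) / c) ≤ B * (1 + (1 + t.card) / c)
        nlinarith
  · intro y hy h
    have hNtot : N y = tot y := max_eq_left (hc y hy)
    have hsum : ∑ z ∈ t, φ z y = 1 := by
      simp only [φ]
      rw [← Finset.sum_div, hNtot]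
      exact div_self (ne_of_gt (hNtot ▸ hN0 y : 0 < tot y))
    -- The weights sum to `1`, so the pair is a convex combination of the local pairs, and so the
    -- local bounds average.
    have hdec : (h, G y h) = ∑ z ∈ t, φ z y • (h, R z h) := by
      refine Prod.ext ?_ ?_
      · rw [Prod.fst_sum]
        simp only [Prod.smul_fst]
        rw [← Finset.sum_smul, hsum, one_smul]
      · rw [Prod.snd_sum, hG]
        rfl
    rw [hdec, map_sum]
    calc _ ≤ ∑ z ∈ t, ‖P y (φ z y • (h, R z h))‖ := norm_sum_le _ _
      _ ≤ ∑ z ∈ t, φ z y * (ε * ‖h‖) := by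
        refine Finset.sum_le_sum fun z hz => ?_
        rw [map_smul, norm_smul, Real.norm_of_nonneg (hφ0 z y)]
        by_cases hyz : dist y z < r z
        · exact mul_le_mul_of_nonneg_left ((hRJ z (htZ z hz)).2 y hyz h) (hφ0 z y)
        · have : φ z y = 0 := by
            simp only [φ, ψ]
            rw [max_eq_right (by linarith), zero_div]
          simp [this]
      _ = ε * ‖h‖ := by rw [← Finset.sum_mul, hsum, one_mul]

end ApproximateInverse

/-! ### Taylor estimates on bounded sets. -/

section Regularity

variable {H E V : Type*} [NormedAddCommGroup H] [NormedSpace ℝ H]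
  [NormedAddCommGroup E] [NormedSpace ℝ E] [NormedAddCommGroup V] [NormedSpace ℝ V]
  {S : H × E → V}

theorem Regular.differentiable (hS : Regular S) : Differentiable ℝ S :=
  hS.contDiff.differentiable (by norm_num)

/-- Postcomposition with a continuous linear map preserves `Regular`. -/
theorem Regular.clm_comp {W : Type*} [NormedAddCommGroup W] [NormedSpace ℝ W] (hS : Regular S)
    (A : V →L[ℝ] W) : Regular fun z => A (S z) := by
  have h1 : fderiv ℝ (fun z => A (S z)) = fun z => A.comp (fderiv ℝ S z) := by
    funext z
    exact (A.hasFDerivAt.comp z (hS.differentiable z).hasFDerivAt).fderiv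
  have hd : Differentiable ℝ (fderiv ℝ S) :=
    (hS.contDiff.fderiv_right (m := 1) (by norm_num)).differentiable (by norm_num)
  have h2 : ∀ z, fderiv ℝ (fderiv ℝ fun z => A (S z)) z =
      (ContinuousLinearMap.compL ℝ (H × E) V W A).comp (fderiv ℝ (fderiv ℝ S) z) := by
    intro z
    rw [h1]
    exact ((ContinuousLinearMap.compL ℝ (H × E) V W A).hasFDerivAt.comp z
      (hd z).hasFDerivAt).fderiv
  refine ⟨A.contDiff.comp hS.contDiff, fun B hB => ?_⟩
  obtain ⟨C, hC⟩ := hS.bounded B hB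
  refine ⟨max (‖A‖ * C) (‖ContinuousLinearMap.compL ℝ (H × E) V W A‖ * C), fun z hz => ⟨?_, ?_⟩⟩
  · rw [h1]
    refine le_trans ?_ (le_max_left _ _)
    exact (A.opNorm_comp_le _).trans (mul_le_mul_of_nonneg_left (hC z hz).1 (norm_nonneg _))
  · rw [h2]
    refine le_trans ?_ (le_max_right _ _)
    exact (ContinuousLinearMap.opNorm_comp_le _ _).trans
      (mul_le_mul_of_nonneg_left (hC z hz).2 (norm_nonneg _))

/-- Both the Lipschitz bound and the quadratic remainder come from the mean value inequality: on the
convex ball for `S` and `fderiv ℝ S`, then on a segment for `S` minus its linear part. -/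
theorem Regular.exists_bounds (hS : Regular S) (r : ℝ) : ∃ C : ℝ≥0,
    (∀ z ∈ Metric.closedBall (0 : H × E) r, ‖fderiv ℝ S z‖ ≤ C) ∧
    LipschitzOnWith C S (Metric.closedBall 0 r) ∧
    ∀ z ∈ Metric.closedBall (0 : H × E) r, ∀ y ∈ Metric.closedBall (0 : H × E) r,
      ‖S y - S z - fderiv ℝ S z (y - z)‖ ≤ C * ‖y - z‖ ^ 2 := by
  obtain ⟨C, hC⟩ := hS.bounded (Metric.closedBall 0 r) Metric.isBounded_closedBall
  have hC' : ∀ z ∈ Metric.closedBall (0 : H × E) r,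
      ‖fderiv ℝ S z‖ ≤ C.toNNReal ∧ ‖fderiv ℝ (fderiv ℝ S) z‖ ≤ C.toNNReal := fun z hz =>
    ⟨(hC z hz).1.trans (Real.le_coe_toNNReal C), (hC z hz).2.trans (Real.le_coe_toNNReal C)⟩
  have hconv : Convex ℝ (Metric.closedBall (0 : H × E) r) := convex_closedBall _ _
  have hd : Differentiable ℝ (fderiv ℝ S) :=
    (hS.contDiff.fderiv_right (m := 1) (by norm_num)).differentiable (by norm_num)
  refine ⟨C.toNNReal, fun z hz => (hC' z hz).1, ?_, fun z hz y hy => ?_⟩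
  · exact hconv.lipschitzOnWith_of_nnnorm_fderiv_le (fun z _ => hS.differentiable z)
      fun z hz => (hC' z hz).1
  · have hseg : segment ℝ z y ⊆ Metric.closedBall (0 : H × E) r := hconv.segment_subset hz hy
    have h1 : ∀ x ∈ segment ℝ z y, ‖fderiv ℝ S x - fderiv ℝ S z‖ ≤ C.toNNReal * ‖y - z‖ := by
      intro x hx
      refine (hconv.norm_image_sub_le_of_norm_fderiv_le (fun w _ => hd w)
        (fun w hw => (hC' w hw).2) hz (hseg hx)).trans ?_
      gcongr
      exact norm_sub_le_of_mem_segment hx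
    have h2 := (convex_segment z y).norm_image_sub_le_of_norm_hasFDerivWithin_le'
      (f := S) (f' := fderiv ℝ S) (φ := fderiv ℝ S z)
      (fun x _ => (hS.differentiable x).hasFDerivAt.hasFDerivWithinAt) h1
      (left_mem_segment ℝ z y) (right_mem_segment ℝ z y)
    rwa [mul_assoc, ← sq] at h2

theorem Regular.isBounded_image (hS : Regular S) {B : Set (H × E)} (hB : Bornology.IsBounded B) :
    Bornology.IsBounded (S '' B) := by
  obtain ⟨r, hr⟩ := hB.subset_closedBall 0
  obtain ⟨C, -, hC, -⟩ := hS.exists_bounds r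
  rw [Metric.isBounded_iff]
  refine ⟨C * (r + r), ?_⟩
  rintro _ ⟨x, hx, rfl⟩ _ ⟨y, hy, rfl⟩
  refine (hC.dist_le_mul x (hr hx) y (hr hy)).trans ?_
  gcongr
  exact (dist_triangle_right x y 0).trans (add_le_add (hr hx) (hr hy))

end Regularity

/-! ### Halving the distance in one step by changing the noise. -/

section OneStep

variable {ι H E V : Type*} [NormedAddCommGroup H] [InnerProductSpace ℝ H]
  [NormedAddCommGroup E] [InnerProductSpace ℝ E] [NormedAddCommGroup V] [NormedSpace ℝ V]
  {emb : V →L[ℝ] H} {S : H × E → V}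

theorem NonDegenerate.exists_finiteRank (e : HilbertBasis ι ℝ E) (hemb : IsCompactOperator emb)
    (hS : Regular S) {K : Set E} (hN : NonDegenerate emb S K) {u : H} {ζ : E} (hζ : ζ ∈ K) {ε : ℝ}
    (hε : 0 < ε) : ∃ (R : H →L[ℝ] E) (J : Finset ι), (∀ h, ∀ j ∉ J, ⟪e j, R h⟫ = 0) ∧
      ∀ h, ‖fderiv ℝ (fun z => emb (S z)) (u, ζ) (h, R h)‖ ≤ ε * ‖h‖ := by
  have h1 : fderiv ℝ (fun z => emb (S z)) (u, ζ) = emb.comp (fderiv ℝ S (u, ζ)) :=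
    (emb.hasFDerivAt.comp (u, ζ) (hS.differentiable (u, ζ)).hasFDerivAt).fderiv
  have h2 : fderiv ℝ (fun x => S (u, x)) ζ =
      (fderiv ℝ S (u, ζ)).comp (ContinuousLinearMap.inr ℝ H E) :=
    ((hS.differentiable (u, ζ)).hasFDerivAt.comp ζ (hasFDerivAt_prodMk_right u ζ)).fderiv
  have hD : IsCompactOperator
      (emb.comp ((fderiv ℝ S (u, ζ)).comp (ContinuousLinearMap.inl ℝ H E))) :=
    hemb.comp_clm ((fderiv ℝ S (u, ζ)).comp (ContinuousLinearMap.inl ℝ H E))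
  have hA : DenseRange
      (emb.comp ((fderiv ℝ S (u, ζ)).comp (ContinuousLinearMap.inr ℝ H E))) := by
    have := hN u ζ hζ
    rw [h2] at this
    exact this
  obtain ⟨R, J, hJ, hR⟩ := exists_finiteRank_norm_add_le e hD hA hε
  refine ⟨R, J, hJ, fun h => ?_⟩
  rw [h1]
  convert hR h using 2
  simp only [ContinuousLinearMap.comp_apply, ContinuousLinearMap.inl_apply,
    ContinuousLinearMap.inr_apply]
  rw [← map_add, ← map_add, Prod.mk_add_mk, add_zero, zero_add]

/-- For two nearby initial points the noise can be modified, with a small change of its law, so that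
the distance between the two trajectories is halved in one step. -/
theorem exists_almostPreserves_halving [MeasurableSpace E] (e : HilbertBasis ι ℝ E)
    (hemb : IsCompactOperator emb) (hS : Regular S) {ℓ : Measure E} {K : Set E}
    (hN : NonDegenerate emb S K) (hs : ∀ j, ShearStable ℓ (e j)) (hK : IsCompact K)
    {X : Set H} (hX : IsCompact X) :
    ∃ δ₀ : ℝ, 0 < δ₀ ∧ ∃ C : ℝ≥0, ∀ u ∈ X, ∀ u' ∈ X, ‖u' - u‖ ≤ δ₀ →
      ∃ Ψ : E → E, AlmostPreserves ℓ Ψ (C * ‖u' - u‖₊) ∧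
        ∀ ζ ∈ K, ‖emb (S (u', Ψ ζ)) - emb (S (u, ζ))‖ ≤ ‖u' - u‖ / 2 := by
  have hF : Regular fun z => emb (S z) := hS.clm_comp emb
  have hcont : Continuous (fderiv ℝ fun z => emb (S z)) :=
    hF.contDiff.continuous_fderiv (by norm_num)
  obtain ⟨G, J, C₁, hGJ, hGb, hGl, hG⟩ := exists_lipschitz_approximate_inverse e hcont
    (hX.prod hK) (ε := 1 / 4) (by norm_num) fun z hz =>
      hN.exists_finiteRank e hemb hS (u := z.1) hz.2 (by norm_num)
  obtain ⟨C₂, hC₂⟩ := exists_almostPreserves_of_shearStable e.orthonormal.norm_eq_one hs J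
  obtain ⟨r₀, hr₀⟩ := (hX.prod hK).isBounded.subset_closedBall (0 : H × E)
  set n : ℝ := (J.card : ℝ) with hn
  have hn0 : 0 ≤ n := Nat.cast_nonneg _
  obtain ⟨C₃, hC₃, -, hT⟩ := hF.exists_bounds (r₀ + (1 + n * C₁))
  -- Two quadratic errors are collected: the Taylor remainder, with increment at most `(1 + n * C₁)
  -- * d`, and the deviation of the composed shears from the intended displacement.
  set C₄ : ℝ := C₃ * ((1 + n * C₁) ^ 2 + n ^ 2 * C₁ ^ 2) with hC₄
  have hC₄0 : 0 ≤ C₄ := by positivity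
  -- The bound `d ≤ 1` keeps the perturbed points in the enlarged ball. The other bound makes `C₄ *
  -- d ^ 2 ≤ d / 4`, which together with the `d / 4` from the approximate inverse gives `d / 2`.
  refine ⟨min 1 (1 / (4 * (C₄ + 1))), by positivity, C₂ * C₁, fun u hu u' hu' hd => ?_⟩
  set h := u' - u with hh
  set d := ‖h‖ with hdef
  have hd1 : d ≤ 1 := hd.trans (min_le_left _ _)
  have hd4 : C₄ * d ≤ 1 / 4 := by
    have := hd.trans (min_le_right _ _)
    rw [le_div_iff₀ (by positivity)] at this
    nlinarith [norm_nonneg h]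
  set M : ℝ≥0 := C₁ * ‖h‖₊ with hM
  have hMd : (M : ℝ) = C₁ * d := by rw [hM]; push_cast; rfl
  obtain ⟨Ψ, hΨ, hΨb⟩ := hC₂ M (fun j ζ => ⟪e j, G (u, ζ) h⟫)
    (fun j => LipschitzWith.of_dist_le_mul fun ζ ζ' => by
      rw [dist_eq_norm, ← inner_sub_right, ← sub_apply]
      refine (norm_inner_le_norm _ _).trans ?_
      rw [e.orthonormal.norm_eq_one, one_mul, hMd]
      refine (ContinuousLinearMap.le_opNorm _ _).trans ?_
      have h1 := hGl.dist_le_mul (u, ζ) (u, ζ')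
      rw [dist_eq_norm, dist_prod_same_left] at h1
      calc _ ≤ (C₁ * dist ζ ζ') * d := by gcongr
        _ = _ := by ring)
    (fun j ζ => by
      refine (norm_inner_le_norm (𝕜 := ℝ) _ _).trans ?_
      rw [e.orthonormal.norm_eq_one, one_mul, hMd]
      exact (ContinuousLinearMap.le_opNorm _ _).trans
        (mul_le_mul_of_nonneg_right (hGb _) (norm_nonneg _)))
  refine ⟨Ψ, by rwa [mul_assoc], fun ζ hζ => ?_⟩
  obtain ⟨hb1, hb2⟩ := hΨb ζ
  rw [← eq_sum_inner_smul e (hGJ (u, ζ) h), hMd] at hb2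
  rw [hMd] at hb1
  have hz : (u, ζ) ∈ Metric.closedBall (0 : H × E) r₀ := hr₀ ⟨hu, hζ⟩
  set z : H × E := (u, ζ) with hzdef
  set y : H × E := (u', Ψ ζ) with hydef
  have hyz : y - z = (h, Ψ ζ - ζ) := rfl
  have hyzn : ‖y - z‖ ≤ (1 + n * C₁) * d := by
    rw [hyz, Prod.norm_def]
    have : 0 ≤ n * C₁ * d := by positivity
    refine max_le ?_ ?_
    · change d ≤ _
      nlinarith
    · refine hb1.trans ?_
      nlinarith [norm_nonneg h]
  have hp : 0 ≤ 1 + n * C₁ := by positivity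
  have hzr : z ∈ Metric.closedBall (0 : H × E) (r₀ + (1 + n * C₁)) :=
    Metric.closedBall_subset_closedBall (by linarith) hz
  have hyr : y ∈ Metric.closedBall (0 : H × E) (r₀ + (1 + n * C₁)) := by
    rw [mem_closedBall_zero_iff] at hz ⊢
    calc ‖y‖ = ‖z + (y - z)‖ := by congr 1; abel
      _ ≤ ‖z‖ + ‖y - z‖ := norm_add_le _ _
      _ ≤ r₀ + (1 + n * C₁) := by
        refine add_le_add hz (hyzn.trans ?_)
        exact mul_le_of_le_one_right hp hd1
  -- Taylor remainder, linear term along the approximate inverse, and the effect of `Ψ ζ` differing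
  -- from `ζ + G z h`.
  have hsplit : emb (S y) - emb (S z) =
      (emb (S y) - emb (S z) - fderiv ℝ (fun z => emb (S z)) z (y - z)) +
      fderiv ℝ (fun z => emb (S z)) z (h, G z h) +
      fderiv ℝ (fun z => emb (S z)) z (0, Ψ ζ - ζ - G z h) := by
    rw [add_assoc, ← map_add, Prod.mk_add_mk, add_zero, add_sub_cancel, hyz, sub_add_cancel]
  have t1 := hT z hzr y hyr
  have t2 := hG z ⟨hu, hζ⟩ h
  have t3 : ‖fderiv ℝ (fun z => emb (S z)) z (0, Ψ ζ - ζ - G z h)‖ ≤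
      C₃ * (n ^ 2 * (C₁ * d) ^ 2) := by
    refine (ContinuousLinearMap.le_opNorm _ _).trans ?_
    refine mul_le_mul (hC₃ z hzr) ?_ (norm_nonneg _) C₃.2
    rw [Prod.norm_def]
    exact max_le (norm_zero.trans_le ((norm_nonneg _).trans hb2)) hb2
  have t4 : (C₃ : ℝ) * ‖y - z‖ ^ 2 ≤ C₃ * ((1 + n * C₁) * d) ^ 2 := by gcongr
  rw [hsplit]
  refine norm_add₃_le.trans ?_
  have t5 : C₃ * ((1 + n * C₁) * d) ^ 2 + C₃ * (n ^ 2 * (C₁ * d) ^ 2) = C₄ * d * d := by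
    rw [hC₄]; ring
  nlinarith [norm_nonneg h]

end OneStep

/-! ### The Markov operator and its dual. -/

section MarkovOperator

/-- The law of `F(u, ζ)` when `u` and `ζ` are independent with laws `μ` and `ℓ`. -/
noncomputable def stepLaw {H E : Type*} [MeasurableSpace H] [MeasurableSpace E] (ℓ : Measure E)
    (F : H × E → H) (μ : Measure H) : Measure H := (μ.prod ℓ).map F

/-- The Markov operator `f ↦ 𝔼 f(F(·, ζ))`, where `ζ` has law `ℓ`. -/
noncomputable def average {H E : Type*} [MeasurableSpace E] (ℓ : Measure E)
    (F : H × E → H) (f : H → ℝ) (u : H) : ℝ := ∫ ζ, f (F (u, ζ)) ∂ℓ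

/-- Bounded measurable functions. -/
structure BoundedMeasurable {H : Type*} [MeasurableSpace H] (f : H → ℝ) : Prop where
  measurable : Measurable f
  bounded : ∃ a, ∀ x, |f x| ≤ a

theorem BoundedMeasurable.integrable {H : Type*} [MeasurableSpace H] {f : H → ℝ}
    (hf : BoundedMeasurable f) (μ : Measure H) [IsFiniteMeasure μ] : Integrable f μ := by
  obtain ⟨a, ha⟩ := hf.bounded
  exact Integrable.of_bound hf.measurable.aestronglyMeasurable a (.of_forall ha)

theorem BoundedMeasurable.comp {H H' : Type*} [MeasurableSpace H] [MeasurableSpace H'] {f : H → ℝ}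
    (hf : BoundedMeasurable f) {g : H' → H} (hg : Measurable g) :
    BoundedMeasurable fun x => f (g x) :=
  ⟨hf.measurable.comp hg, hf.bounded.imp fun _ ha _ => ha _⟩

variable {H E : Type*} [MeasurableSpace H] [MeasurableSpace E] {ℓ : Measure E}
  [IsProbabilityMeasure ℓ] {F : H × E → H}

theorem isProbabilityMeasure_stepLaw (hF : Measurable F) (μ : Measure H) [IsProbabilityMeasure μ] :
    IsProbabilityMeasure (stepLaw ℓ F μ) :=
  Measure.isProbabilityMeasure_map hF.aemeasurable

theorem isProbabilityMeasure_iterate_stepLaw (hF : Measurable F) (μ : Measure H)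
    [hμ : IsProbabilityMeasure μ] (k : ℕ) : IsProbabilityMeasure ((stepLaw ℓ F)^[k] μ) := by
  induction k generalizing μ with
  | zero => exact hμ
  | succ k ih =>
    rw [Function.iterate_succ_apply]
    have := isProbabilityMeasure_stepLaw (ℓ := ℓ) hF μ
    exact ih _

theorem BoundedMeasurable.average (hF : Measurable F) {f : H → ℝ} (hf : BoundedMeasurable f) :
    BoundedMeasurable (average ℓ F f) := by
  obtain ⟨a, ha⟩ := hf.bounded
  refine ⟨?_, a, fun u => ?_⟩
  · have h : StronglyMeasurable fun z : H × E => f (F z) :=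
      (hf.measurable.comp hF).stronglyMeasurable
    exact h.integral_prod_right'.measurable
  · have := norm_integral_le_of_norm_le_const (μ := ℓ) (f := fun ζ => f (F (u, ζ)))
      (.of_forall fun ζ => ha _)
    simpa [RDS.average] using this

theorem BoundedMeasurable.iterate_average (hF : Measurable F) {f : H → ℝ}
    (hf : BoundedMeasurable f) (k : ℕ) : BoundedMeasurable ((RDS.average ℓ F)^[k] f) := by
  induction k with
  | zero => exact hf
  | succ k ih =>
    rw [Function.iterate_succ_apply']
    exact ih.average hF

theorem integral_stepLaw (hF : Measurable F) {f : H → ℝ} (hf : BoundedMeasurable f)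
    (μ : Measure H) [IsProbabilityMeasure μ] :
    ∫ x, f x ∂(stepLaw ℓ F μ) = ∫ u, average ℓ F f u ∂μ := by
  rw [stepLaw, integral_map hF.aemeasurable hf.measurable.aestronglyMeasurable,
    integral_prod _ ((hf.comp hF).integrable _)]
  rfl

theorem integral_iterate_stepLaw (hF : Measurable F) {f : H → ℝ} (hf : BoundedMeasurable f)
    (μ : Measure H) [IsProbabilityMeasure μ] (k : ℕ) :
    ∫ x, f x ∂((stepLaw ℓ F)^[k] μ) = ∫ u, (average ℓ F)^[k] f u ∂μ := by
  induction k generalizing μ with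
  | zero => rfl
  | succ k ih =>
    have := isProbabilityMeasure_stepLaw (ℓ := ℓ) hF μ
    rw [Function.iterate_succ_apply, ih, integral_stepLaw hF (hf.iterate_average hF k),
      Function.iterate_succ_apply']

theorem stepLaw_mul_le (hF : Measurable F) (μ : Measure H) [IsProbabilityMeasure μ] {A B : Set H}
    {N : Set E} (hB : MeasurableSet B) (h : ∀ u ∈ A, ∀ ζ ∈ N, F (u, ζ) ∈ B) :
    μ A * ℓ N ≤ stepLaw ℓ F μ B := by
  rw [stepLaw, Measure.map_apply hF hB, ← Measure.prod_prod]
  exact measure_mono fun z hz => h z.1 hz.1 z.2 hz.2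

theorem stepLaw_compl_eq_zero (hF : Measurable F) (μ : Measure H) [IsProbabilityMeasure μ]
    {A B : Set H} {N : Set E} (hA : μ Aᶜ = 0) (hN : ℓ Nᶜ = 0) (hB : MeasurableSet B)
    (h : ∀ u ∈ A, ∀ ζ ∈ N, F (u, ζ) ∈ B) : stepLaw ℓ F μ Bᶜ = 0 := by
  rw [stepLaw, Measure.map_apply hF hB.compl]
  have h1 : (μ.prod ℓ) (Aᶜ ×ˢ Set.univ) = 0 := by rw [Measure.prod_prod, hA, zero_mul]
  have h2 : (μ.prod ℓ) (Set.univ ×ˢ Nᶜ) = 0 := by rw [Measure.prod_prod, hN, mul_zero]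
  refine measure_mono_null (fun z hz => ?_) (measure_union_null h1 h2)
  by_contra hcon
  simp only [Set.mem_union, Set.mem_prod, Set.mem_compl_iff, Set.mem_univ, and_true, true_and,
    not_or, not_not] at hcon
  exact hz (h z.1 hcon.1 z.2 hcon.2)

theorem iterate_stepLaw_compl_eq_zero (hF : Measurable F) (μ : Measure H) [IsProbabilityMeasure μ]
    {A : Set H} {N : Set E} (hA : μ Aᶜ = 0) (hN : ℓ Nᶜ = 0) (hAm : MeasurableSet A)
    (h : ∀ u ∈ A, ∀ ζ ∈ N, F (u, ζ) ∈ A) (k : ℕ) : (stepLaw ℓ F)^[k] μ Aᶜ = 0 := by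
  induction k with
  | zero => exact hA
  | succ k ih =>
    rw [Function.iterate_succ_apply']
    have := isProbabilityMeasure_iterate_stepLaw (ℓ := ℓ) hF μ k
    exact stepLaw_compl_eq_zero hF _ ih hN hAm h

theorem iterate_average_eq_integral [MeasurableSingletonClass H] (hF : Measurable F) {f : H → ℝ}
    (hf : BoundedMeasurable f) (u : H) (k : ℕ) :
    (average ℓ F)^[k] f u = ∫ x, f x ∂((stepLaw ℓ F)^[k] (Measure.dirac u)) := by
  rw [integral_iterate_stepLaw hF hf, integral_dirac]

end MarkovOperator

/-! ### Comparison of means through independent copies. -/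

section Oscillation

/-- If `f` varies on `X` by at most `a`, and on `B` by at most `a / 2`, then its means with respect
to two measures that charge `B` differ by less than `a`. -/
theorem abs_integral_sub_integral_le {H : Type*} [MeasurableSpace H] {f : H → ℝ}
    (hf : BoundedMeasurable f) {X B : Set H} (hB : MeasurableSet B) {a p : ℝ} (ha : 0 ≤ a)
    (hp : 0 ≤ p) (hfX : ∀ x ∈ X, ∀ y ∈ X, |f x - f y| ≤ a)
    (hfB : ∀ x ∈ X ∩ B, ∀ y ∈ X ∩ B, |f x - f y| ≤ a / 2) (μ ν : Measure H)
    [IsProbabilityMeasure μ] [IsProbabilityMeasure ν] (hμX : μ Xᶜ = 0) (hνX : ν Xᶜ = 0)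
    (hμB : p ≤ μ.real B) (hνB : p ≤ ν.real B) :
    |∫ x, f x ∂μ - ∫ x, f x ∂ν| ≤ (1 - p ^ 2 / 2) * a := by
  -- The product measure serves as coupling: both components lie in `B` with probability at least `p
  -- ^ 2`, and there the difference is at most `a / 2`.
  have h1 : ∫ x, f x ∂μ - ∫ x, f x ∂ν = ∫ z : H × H, (f z.1 - f z.2) ∂(μ.prod ν) := by
    rw [integral_sub ((hf.comp measurable_fst).integrable _)
      ((hf.comp measurable_snd).integrable _)]
    congr 1
    · rw [integral_fun_fst]; simp
    · rw [integral_fun_snd]; simp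
  have hae : ∀ᵐ z ∂(μ.prod ν), ‖f z.1 - f z.2‖ ≤ a - (B ×ˢ B).indicator (fun _ => a / 2) z := by
    have h1 : ∀ᵐ z ∂(μ.prod ν), z.1 ∈ X := Measure.quasiMeasurePreserving_fst.ae hμX
    have h2 : ∀ᵐ z ∂(μ.prod ν), z.2 ∈ X := Measure.quasiMeasurePreserving_snd.ae hνX
    filter_upwards [h1, h2] with z hz1 hz2
    by_cases hz : z ∈ B ×ˢ B
    · rw [Set.indicator_of_mem hz]
      refine (hfB _ ⟨hz1, hz.1⟩ _ ⟨hz2, hz.2⟩).trans (by linarith)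
    · rw [Set.indicator_of_notMem hz, sub_zero]
      exact hfX _ hz1 _ hz2
  rw [h1]
  have hbound : Integrable (fun z => a - (B ×ˢ B).indicator (fun _ => a / 2) z) (μ.prod ν) :=
    (integrable_const a).sub ((integrable_const _).indicator (hB.prod hB))
  refine (norm_integral_le_of_norm_le hbound hae).trans ?_
  rw [integral_sub (integrable_const a) ((integrable_const _).indicator (hB.prod hB)),
    integral_indicator_const _ (hB.prod hB), measureReal_prod_prod]
  simp only [integral_const, probReal_univ, smul_eq_mul, one_mul]
  have : p ^ 2 ≤ μ.real B * ν.real B := by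
    rw [sq]; exact mul_le_mul hμB hνB hp (measureReal_nonneg)
  nlinarith

end Oscillation

/-! ### Contraction of the truncated Lipschitz seminorm. -/

section LocalContraction

/-- `f` is `a`-Lipschitz on `X` for the distance `min 1 (‖x - y‖ / δ)`. -/
def TruncLipschitzOn {H : Type*} [NormedAddCommGroup H] (δ a : ℝ) (X : Set H) (f : H → ℝ) : Prop :=
  ∀ x ∈ X, ∀ y ∈ X, |f x - f y| ≤ a * min 1 (‖x - y‖ / δ)

theorem TruncLipschitzOn.abs_sub_le {H : Type*} [NormedAddCommGroup H] {δ a : ℝ} {X : Set H}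
    {f : H → ℝ} (ha : 0 ≤ a) (hf : TruncLipschitzOn δ a X f) {x y : H}
    (hx : x ∈ X) (hy : y ∈ X) : |f x - f y| ≤ a :=
  (hf x hx y hy).trans (mul_le_of_le_one_right ha (min_le_left _ _))

variable {H E : Type*} [NormedAddCommGroup H] [MeasurableSpace H] [MeasurableSpace E]
  {ℓ : Measure E} [IsProbabilityMeasure ℓ] {F : H × E → H} {K : Set E} {X : Set H} {δ : ℝ}
  {C : ℝ≥0} {f : H → ℝ} {a : ℝ}

/-- With `d = ‖u' - u‖`, replacing `ζ` by `Ψ ζ` at `u'` costs `2 * a * C * d`. Then the halved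
distance contributes `a * d / (2 * δ)`, and the event `Ψ ζ ∉ K`, of probability at most `C * d`,
costs at most `a * C * d`. The condition `12 * C * δ ≤ 1` bounds the total `C`-part by a quarter of
`a * d / δ`. -/
theorem TruncLipschitzOn.abs_average_sub_le_of_norm_sub_le (hF : Measurable F)
    (hK : MeasurableSet K) (hℓK : ℓ Kᶜ = 0) (hXK : ∀ u ∈ X, ∀ ζ ∈ K, F (u, ζ) ∈ X) (hδ : 0 < δ)
    (hCδ : 12 * C * δ ≤ 1) (ha : 0 ≤ a) (hfm : BoundedMeasurable f) (hf : TruncLipschitzOn δ a X f)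
    {u u' : H} (hu : u ∈ X) (hu' : u' ∈ X) {Ψ : E → E}
    (hΨ : AlmostPreserves ℓ Ψ (C * ‖u' - u‖₊))
    (hΨK : ∀ ζ ∈ K, ‖F (u', Ψ ζ) - F (u, ζ)‖ ≤ ‖u' - u‖ / 2) :
    |average ℓ F f u' - average ℓ F f u| ≤ 3 / 4 * a * (‖u' - u‖ / δ) := by
  set d := ‖u' - u‖ with hd
  have hd0 : 0 ≤ d := norm_nonneg _
  have haeK : ∀ᵐ ζ ∂ℓ, ζ ∈ K := hℓK
  have hFu : ∀ v : H, Measurable fun ζ => F (v, ζ) := fun v => hF.comp measurable_prodMk_left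
  -- The oscillation of `f` is controlled only on `X`, and `Ψ ζ` may leave `K`. Subtracting `f u`
  -- and cutting off outside `K` yields a function bounded by `a` everywhere.
  let g : E → ℝ := K.indicator fun ζ => f (F (u', ζ)) - f u
  let g' : E → ℝ := fun ζ => f (F (u, ζ)) - f u
  have hgm : Measurable g := ((hfm.measurable.comp (hFu u')).sub_const _).indicator hK
  have hga : ∀ ζ, |g ζ| ≤ a := by
    intro ζ
    by_cases hζ : ζ ∈ K
    · simp only [g, Set.indicator_of_mem hζ]
      exact hf.abs_sub_le ha (hXK u' hu' ζ hζ) hu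
    · simpa [g, Set.indicator_of_notMem hζ] using ha
  have hgi : Integrable g ℓ := BoundedMeasurable.integrable ⟨hgm, a, hga⟩ ℓ
  have hgΨi : Integrable (fun ζ => g (Ψ ζ)) ℓ :=
    (BoundedMeasurable.comp ⟨hgm, a, hga⟩ hΨ.measurable).integrable ℓ
  have hg'i : Integrable g' ℓ := ((hfm.comp (hFu u)).integrable ℓ).sub (integrable_const _)
  have e1 : average ℓ F f u' - f u = ∫ ζ, g ζ ∂ℓ := by
    have : ∫ ζ, g ζ ∂ℓ = ∫ ζ, (f (F (u', ζ)) - f u) ∂ℓ := by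
      refine integral_congr_ae ?_
      filter_upwards [haeK] with ζ hζ
      simp only [g, Set.indicator_of_mem hζ]
    rw [this, integral_sub ((hfm.comp (hFu u')).integrable ℓ) (integrable_const _)]
    simp [average]
  have e2 : average ℓ F f u - f u = ∫ ζ, g' ζ ∂ℓ := by
    rw [integral_sub ((hfm.comp (hFu u)).integrable ℓ) (integrable_const _)]
    simp [average]
  have h1 := hΨ.abs_integral_sub_le hgm hga
  have hΨKm : MeasurableSet (Ψ ⁻¹' K) := hΨ.measurable hK
  have hbad : ℓ.real (Ψ ⁻¹' K)ᶜ ≤ C * d := by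
    have h2 := hΨ.measureReal_le hK
    have h3 : ℓ.real K = 1 := by
      rw [← probReal_univ (μ := ℓ)]
      exact measureReal_congr (eventuallyEq_univ.2 hℓK)
    rw [probReal_compl_eq_one_sub hΨKm]
    push_cast at h2
    rw [h3] at h2
    change 1 ≤ ℓ.real (Ψ ⁻¹' K) + C * d at h2
    linarith
  have h2 : |∫ ζ, g (Ψ ζ) ∂ℓ - ∫ ζ, g' ζ ∂ℓ| ≤ a * (d / 2 / δ) + a * (C * d) := by
    rw [← integral_sub hgΨi hg'i]
    have hbound : Integrable (fun ζ => a * (d / 2 / δ) + (Ψ ⁻¹' K)ᶜ.indicator (fun _ => a) ζ) ℓ :=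
      (integrable_const _).add ((integrable_const _).indicator hΨKm.compl)
    rw [← Real.norm_eq_abs]
    refine (norm_integral_le_of_norm_le (f := fun ζ => g (Ψ ζ) - g' ζ) hbound ?_).trans ?_
    · filter_upwards [haeK] with ζ hζ
      by_cases hζΨ : Ψ ζ ∈ K
      · have hmem : ζ ∉ (Ψ ⁻¹' K)ᶜ := fun h => h hζΨ
        rw [Set.indicator_of_notMem hmem, add_zero]
        simp only [g, g', Set.indicator_of_mem hζΨ, sub_sub_sub_cancel_right]
        refine (hf _ (hXK u' hu' _ hζΨ) _ (hXK u hu _ hζ)).trans ?_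
        refine mul_le_mul_of_nonneg_left ((min_le_right _ _).trans ?_) ha
        exact div_le_div_of_nonneg_right (hΨK ζ hζ) hδ.le
      · have hmem : ζ ∈ (Ψ ⁻¹' K)ᶜ := hζΨ
        rw [Set.indicator_of_mem hmem]
        simp only [g, g', Set.indicator_of_notMem hζΨ, zero_sub, norm_neg]
        have := hf.abs_sub_le ha (hXK u hu _ hζ) hu
        rw [Real.norm_eq_abs]
        have : 0 ≤ a * (d / 2 / δ) := by positivity
        linarith
    · rw [integral_add (integrable_const _) ((integrable_const _).indicator hΨKm.compl),
        integral_indicator_const _ hΨKm.compl]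
      simp only [integral_const, probReal_univ, smul_eq_mul, one_mul]
      nlinarith
  have h3 : |∫ ζ, g ζ ∂ℓ - ∫ ζ, g (Ψ ζ) ∂ℓ| ≤ 2 * a * (C * d) := by
    refine h1.trans_eq ?_
    push_cast
    rfl
  have h4 : average ℓ F f u' - average ℓ F f u =
      (∫ ζ, g ζ ∂ℓ - ∫ ζ, g (Ψ ζ) ∂ℓ) + (∫ ζ, g (Ψ ζ) ∂ℓ - ∫ ζ, g' ζ ∂ℓ) := by
    rw [← e1, ← e2]
    ring
  rw [h4]
  refine (abs_add_le _ _).trans ((add_le_add h3 h2).trans ?_)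
  have h5 : C * d ≤ (d / δ) / 12 := by
    rw [le_div_iff₀ (by norm_num), le_div_iff₀ hδ]
    nlinarith
  have h6 : d / 2 / δ = (d / δ) / 2 := by ring
  rw [h6]
  nlinarith [mul_le_mul_of_nonneg_left h5 ha]

/-- The property of `F` and `ℓ` established by `exists_almostPreserves_halving`. -/
def Halving (ℓ : Measure E) (F : H × E → H) (K : Set E) (X : Set H) (δ : ℝ) (C : ℝ≥0) : Prop :=
  ∀ u ∈ X, ∀ u' ∈ X, ‖u' - u‖ ≤ δ → ∃ Ψ : E → E, AlmostPreserves ℓ Ψ (C * ‖u' - u‖₊) ∧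
    ∀ ζ ∈ K, ‖F (u', Ψ ζ) - F (u, ζ)‖ ≤ ‖u' - u‖ / 2

/-- The seminorm never grows: close points contract, and for distant ones the oscillation bound `a`
is inherited by averages. -/
theorem TruncLipschitzOn.average (hF : Measurable F)
    (hK : MeasurableSet K) (hℓK : ℓ Kᶜ = 0) (hXK : ∀ u ∈ X, ∀ ζ ∈ K, F (u, ζ) ∈ X) (hδ : 0 < δ)
    (hCδ : 12 * C * δ ≤ 1) (hh : Halving ℓ F K X δ C) (ha : 0 ≤ a) (hfm : BoundedMeasurable f)
    (hf : TruncLipschitzOn δ a X f) : TruncLipschitzOn δ a X (average ℓ F f) := by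
  intro x hx y hy
  have hFu : ∀ v : H, Measurable fun ζ => F (v, ζ) := fun v => hF.comp measurable_prodMk_left
  rcases le_or_gt ‖x - y‖ δ with hxy | hxy
  · obtain ⟨Ψ, hΨ, hΨK⟩ := hh y hy x hx hxy
    have h1 := hf.abs_average_sub_le_of_norm_sub_le hF hK hℓK hXK hδ hCδ ha hfm hy hx hΨ hΨK
    have h2 : ‖x - y‖ / δ ≤ 1 := (div_le_one hδ).2 hxy
    rw [min_eq_right h2]
    have : 0 ≤ a * (‖x - y‖ / δ) := by positivity
    linarith
  · rw [min_eq_left ((one_le_div hδ).2 hxy.le), mul_one]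
    unfold RDS.average
    rw [← integral_sub ((hfm.comp (hFu x)).integrable ℓ) ((hfm.comp (hFu y)).integrable ℓ)]
    have := norm_integral_le_of_norm_le_const (μ := ℓ)
      (f := fun ζ => f (F (x, ζ)) - f (F (y, ζ))) (C := a) (by
        have haeK : ∀ᵐ ζ ∂ℓ, ζ ∈ K := hℓK
        filter_upwards [haeK] with ζ hζ
        exact hf.abs_sub_le ha (hXK x hx ζ hζ) (hXK y hy ζ hζ))
    simpa using this

theorem TruncLipschitzOn.iterate_average (hF : Measurable F)
    (hK : MeasurableSet K) (hℓK : ℓ Kᶜ = 0) (hXK : ∀ u ∈ X, ∀ ζ ∈ K, F (u, ζ) ∈ X) (hδ : 0 < δ)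
    (hCδ : 12 * C * δ ≤ 1) (hh : Halving ℓ F K X δ C) (ha : 0 ≤ a) (hfm : BoundedMeasurable f)
    (hf : TruncLipschitzOn δ a X f) (k : ℕ) :
    TruncLipschitzOn δ a X ((RDS.average ℓ F)^[k] f) := by
  induction k with
  | zero => exact hf
  | succ k ih =>
    rw [Function.iterate_succ_apply']
    exact ih.average hF hK hℓK hXK hδ hCδ hh ha (hfm.iterate_average hF k)

/-- A weak form of Harris' theorem: local contraction and a uniform lower bound for the probability
to visit a small set yield a global contraction. -/
theorem TruncLipschitzOn.iterate_average_contraction [BorelSpace H] (hF : Measurable F)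
    (hK : MeasurableSet K) (hℓK : ℓ Kᶜ = 0) (hXm : MeasurableSet X)
    (hXK : ∀ u ∈ X, ∀ ζ ∈ K, F (u, ζ) ∈ X) (hδ : 0 < δ)
    (hCδ : 12 * C * δ ≤ 1) (hh : Halving ℓ F K X δ C) {m : ℕ} {p : ℝ} (hp : 0 ≤ p)
    (hvisit : ∀ u ∈ X, p ≤
      ((stepLaw ℓ F)^[m + 1] (Measure.dirac u)).real (Metric.closedBall 0 (δ / 4)))
    (ha : 0 ≤ a) (hfm : BoundedMeasurable f) (hf : TruncLipschitzOn δ a X f) :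
    TruncLipschitzOn δ (max (3 / 4) (1 - p ^ 2 / 2) * a) X ((RDS.average ℓ F)^[m + 1] f) := by
  intro x hx y hy
  rcases le_or_gt ‖x - y‖ δ with hxy | hxy
  · obtain ⟨Ψ, hΨ, hΨK⟩ := hh y hy x hx hxy
    -- The first `m` applications preserve the constant `a`; the last one supplies the factor `3 /
    -- 4`.
    have hm := hf.iterate_average hF hK hℓK hXK hδ hCδ hh ha hfm m
    have h1 := hm.abs_average_sub_le_of_norm_sub_le
      hF hK hℓK hXK hδ hCδ ha (hfm.iterate_average hF m) hy hx hΨ hΨK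
    rw [Function.iterate_succ_apply', min_eq_right ((div_le_one hδ).2 hxy)]
    refine h1.trans ?_
    gcongr
    exact le_max_left _ _
  · rw [min_eq_left ((one_le_div hδ).2 hxy.le), mul_one, iterate_average_eq_integral hF hfm,
      iterate_average_eq_integral hF hfm]
    have hp1 := isProbabilityMeasure_iterate_stepLaw (ℓ := ℓ) hF (Measure.dirac x) (m + 1)
    have hp2 := isProbabilityMeasure_iterate_stepLaw (ℓ := ℓ) hF (Measure.dirac y) (m + 1)
    have hdirac : ∀ z ∈ X, Measure.dirac z Xᶜ = 0 := fun z hz => by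
      rw [Measure.dirac_apply' _ hXm.compl]; simp [hz]
    refine (abs_integral_sub_integral_le hfm (X := X) (B := Metric.closedBall 0 (δ / 4))
      Metric.isClosed_closedBall.measurableSet ha hp (fun x hx y hy => hf.abs_sub_le ha hx hy)
      ?_ _ _
      (iterate_stepLaw_compl_eq_zero hF _ (hdirac x hx) hℓK hXm hXK _)
      (iterate_stepLaw_compl_eq_zero hF _ (hdirac y hy) hℓK hXm hXK _)
      (hvisit x hx) (hvisit y hy)).trans ?_
    · intro z hz w hw
      refine (hf z hz.1 w hw.1).trans ?_
      have h1 := mem_closedBall_zero_iff.1 hz.2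
      have h2 := mem_closedBall_zero_iff.1 hw.2
      -- The ball of radius `δ / 4` has diameter at most `δ / 2`, so `f` varies there by at most `a
      -- / 2`.
      have h3 : ‖z - w‖ / δ ≤ 1 / 2 := by
        rw [div_le_iff₀ hδ]
        linarith [norm_sub_le z w]
      have := mul_le_mul_of_nonneg_left ((min_le_right 1 (‖z - w‖ / δ)).trans h3) ha
      linarith
    · gcongr
      exact le_max_right _ _

end LocalContraction

/-! ### Visits to small balls and exponential mixing on an invariant set. -/

section Mixing

/-- Noise in a small ball `N` around `0` gives `‖F (u, ζ)‖ ≤ γ * ‖u‖ + ε`. If it stays in `N` for `m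
+ 1` steps, which has probability `ℓ N ^ (m + 1) > 0`, the norm follows the recursion `r ↦ γ * r +
ε` and falls below `τ`. -/
theorem exists_visit_probability {H E : Type*} [NormedAddCommGroup H] [NormedSpace ℝ H]
    [MeasurableSpace H] [BorelSpace H] [NormedAddCommGroup E] [NormedSpace ℝ E] [MeasurableSpace E]
    {ℓ : Measure E} [IsProbabilityMeasure ℓ] {F : H × E → H} (hFm : Measurable F)
    (hF : Regular F) (h0 : (0 : E) ∈ ℓ.support) {γ : ℝ} (hγ0 : 0 < γ) (hγ1 : γ < 1)
    (hγ : ∀ u, ‖F (u, 0)‖ ≤ γ * ‖u‖) {R τ : ℝ} (hR : 0 < R) (hτ : 0 < τ) :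
    ∃ (m : ℕ) (p : ℝ), 0 < p ∧ ∀ u : H, ‖u‖ ≤ R → p ≤
      ((stepLaw ℓ F)^[m + 1] (Measure.dirac u)).real (Metric.closedBall 0 τ) := by
  have hγ' : 0 < 1 - γ := by linarith
  -- The first bound keeps the radii below `R`, where the Lipschitz constant `L` applies; the second
  -- puts the fixed point `ε / (1 - γ)` below `τ / 2`.
  set ε : ℝ := min ((1 - γ) * R) ((1 - γ) * (τ / 2)) with hε
  have hε0 : 0 < ε := by positivity
  have hεR : ε ≤ (1 - γ) * R := min_le_left _ _
  have hετ : ε ≤ (1 - γ) * (τ / 2) := min_le_right _ _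
  obtain ⟨L, -, hL, -⟩ := hF.exists_bounds (R + 1)
  set s : ℝ := min 1 (ε / (L + 1)) with hs
  have hs0 : 0 < s := by positivity
  let N : Set E := Metric.ball 0 s
  have hN : 0 < ℓ N := (Measure.mem_support_iff_forall _).1 h0 N (Metric.ball_mem_nhds 0 hs0)
  have hstep : ∀ u : H, ‖u‖ ≤ R → ∀ ζ ∈ N, ‖F (u, ζ)‖ ≤ γ * ‖u‖ + ε := by
    intro u hu ζ hζ
    have hζ' : ‖ζ‖ < s := mem_ball_zero_iff.1 hζ
    have hζ1 : ‖ζ‖ ≤ 1 := hζ'.le.trans (min_le_left _ _)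
    have m1 : (u, ζ) ∈ Metric.closedBall (0 : H × E) (R + 1) := by
      rw [mem_closedBall_zero_iff, Prod.norm_def]
      exact max_le (by linarith) (hζ1.trans (by linarith))
    have m2 : (u, (0 : E)) ∈ Metric.closedBall (0 : H × E) (R + 1) := by
      rw [mem_closedBall_zero_iff, Prod.norm_def]
      exact max_le (by linarith) (by rw [norm_zero]; linarith)
    have h1 := hL.dist_le_mul _ m1 _ m2
    rw [dist_prod_same_left, dist_zero_right, dist_eq_norm] at h1
    have h2 : (L : ℝ) * ‖ζ‖ ≤ ε := by
      have h3 : ‖ζ‖ ≤ ε / (L + 1) := hζ'.le.trans (min_le_right _ _)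
      rw [le_div_iff₀ (by positivity)] at h3
      nlinarith [norm_nonneg ζ]
    calc ‖F (u, ζ)‖ = ‖F (u, 0) + (F (u, ζ) - F (u, 0))‖ := by congr 1; abel
      _ ≤ _ := norm_add_le _ _
      _ ≤ _ := add_le_add (hγ u) (h1.trans h2)
  let rad : ℕ → ℝ := fun k => (fun r => γ * r + ε)^[k] R
  have hrads : ∀ k, rad (k + 1) = γ * rad k + ε := fun k => Function.iterate_succ_apply' _ _ _
  have hradR : ∀ k, rad k ≤ R := by
    intro k
    induction k with
    | zero => exact le_rfl
    | succ k ih =>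
      rw [hrads]
      nlinarith
  have hradτ : ∀ k, rad k ≤ γ ^ k * R + τ / 2 := by
    intro k
    induction k with
    | zero => change R ≤ _; simp; linarith
    | succ k ih =>
      rw [hrads, pow_succ]
      nlinarith
  obtain ⟨m, hm⟩ := exists_pow_lt_of_lt_one (show 0 < τ / 2 / R by positivity) hγ1
  rw [lt_div_iff₀ hR] at hm
  refine ⟨m, (ℓ.real N) ^ (m + 1), ?_, fun u hu => ?_⟩
  · exact pow_pos (ENNReal.toReal_pos hN.ne' (measure_ne_top _ _)) _
  have hprob := fun k => isProbabilityMeasure_iterate_stepLaw (ℓ := ℓ) hFm (Measure.dirac u) k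
  have hk : ∀ k, ℓ N ^ k ≤ (stepLaw ℓ F)^[k] (Measure.dirac u) (Metric.closedBall 0 (rad k)) := by
    intro k
    induction k with
    | zero =>
      have : u ∈ Metric.closedBall (0 : H) (rad 0) := by simpa [rad] using hu
      simp [this]
    | succ k ih =>
      rw [Function.iterate_succ_apply', pow_succ]
      have := hprob k
      refine le_trans ?_ (stepLaw_mul_le hFm _ (A := Metric.closedBall 0 (rad k)) (N := N)
        Metric.isClosed_closedBall.measurableSet fun v hv ζ hζ => ?_)
      · gcongr
      · rw [mem_closedBall_zero_iff] at hv ⊢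
        rw [hrads]
        refine (hstep v (hv.trans (hradR k)) ζ hζ).trans ?_
        gcongr
  have hfin : (stepLaw ℓ F)^[m + 1] (Measure.dirac u) (Metric.closedBall 0 (rad (m + 1))) ≤
      (stepLaw ℓ F)^[m + 1] (Measure.dirac u) (Metric.closedBall 0 τ) := by
    refine measure_mono (Metric.closedBall_subset_closedBall ((hradτ _).trans ?_))
    rw [pow_succ]
    nlinarith [mul_pos (pow_pos hγ0 m) hR]
  have := hprob (m + 1)
  have h1 := ENNReal.toReal_mono (measure_ne_top _ _) ((hk (m + 1)).trans hfin)
  rwa [ENNReal.toReal_pow] at h1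

/-- Take `κ = α ^ (1 / (m + 1))`. Rounding `k / (m + 1)` down loses at most one factor `α`. -/
theorem pow_div_le_mul_pow {α : ℝ} (hα0 : 0 < α) (hα1 : α < 1) (m : ℕ) :
    ∃ κ : ℝ, 0 < κ ∧ κ < 1 ∧ ∀ k : ℕ, α ^ (k / (m + 1)) ≤ α⁻¹ * κ ^ k := by
  have hm : ((m + 1 : ℕ) : ℝ) ≠ 0 := by positivity
  set κ : ℝ := α ^ (((m + 1 : ℕ) : ℝ)⁻¹) with hκ
  have hκm : κ ^ (m + 1) = α := Real.rpow_inv_natCast_pow hα0.le (by simp)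
  have hκ0 : 0 < κ := Real.rpow_pos_of_pos hα0 _
  have hκ1 : κ < 1 := Real.rpow_lt_one hα0.le hα1 (by positivity)
  refine ⟨κ, hκ0, hκ1, fun k => ?_⟩
  rw [le_inv_mul_iff₀ hα0, ← pow_succ']
  rw [← hκm, ← pow_mul]
  refine pow_le_pow_of_le_one hκ0.le hκ1.le ?_
  exact (Nat.lt_mul_div_succ k (Nat.succ_pos m)).le

/-- Exponential mixing for initial laws on an invariant set. -/
theorem exists_mixing_of_halving {H E : Type*} [NormedAddCommGroup H] [NormedSpace ℝ H]
    [MeasurableSpace H] [BorelSpace H] [NormedAddCommGroup E] [NormedSpace ℝ E] [MeasurableSpace E]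
    {ℓ : Measure E} [IsProbabilityMeasure ℓ] {F : H × E → H} (hFm : Measurable F)
    (hF : Regular F) (h0 : (0 : E) ∈ ℓ.support) {γ : ℝ} (hγ0 : 0 < γ) (hγ1 : γ < 1)
    (hγ : ∀ u, ‖F (u, 0)‖ ≤ γ * ‖u‖) {R : ℝ} (hR : 0 < R) {K : Set E} (hK : MeasurableSet K)
    (hℓK : ℓ Kᶜ = 0) {X : Set H} (hXm : MeasurableSet X) (hXR : X ⊆ Metric.closedBall 0 R)
    (hXK : ∀ u ∈ X, ∀ ζ ∈ K, F (u, ζ) ∈ X) {δ₀ : ℝ} (hδ₀ : 0 < δ₀) {C : ℝ≥0}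
    (hh : Halving ℓ F K X δ₀ C) :
    ∃ A κ : ℝ, 0 < A ∧ 0 < κ ∧ κ < 1 ∧ ∀ μ ν : Measure H, IsProbabilityMeasure μ →
      IsProbabilityMeasure ν → μ Xᶜ = 0 → ν Xᶜ = 0 → ∀ f : H → ℝ, (∀ x, |f x| ≤ 1) →
        LipschitzWith 1 f → ∀ k : ℕ,
          |∫ x, f x ∂((stepLaw ℓ F)^[k] μ) - ∫ x, f x ∂((stepLaw ℓ F)^[k] ν)| ≤ A * κ ^ k := by
  -- `δ ≤ δ₀` keeps the halving property, `δ ≤ 1` lets Lipschitz test functions satisfy the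
  -- truncated bound with constant `2`, and the last term ensures `12 * C * δ ≤ 1`.
  set δ : ℝ := min δ₀ (min 1 (1 / (12 * C + 1))) with hδ
  have hδ0 : 0 < δ := by positivity
  have hδ1 : δ ≤ 1 := (min_le_right _ _).trans (min_le_left _ _)
  have hCδ : 12 * C * δ ≤ 1 := by
    have h1 : δ ≤ 1 / (12 * C + 1) := (min_le_right _ _).trans (min_le_right _ _)
    rw [le_div_iff₀ (by positivity)] at h1
    nlinarith
  have hhδ : Halving ℓ F K X δ C := fun u hu u' hu' h => hh u hu u' hu' (h.trans (min_le_left _ _))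
  obtain ⟨m, p, hp, hvisit⟩ := exists_visit_probability hFm hF h0 hγ0 hγ1 hγ hR
    (show 0 < δ / 4 by positivity)
  set α : ℝ := max (3 / 4) (1 - p ^ 2 / 2) with hα
  have hα0 : 0 < α := lt_max_of_lt_left (by norm_num)
  have hα1 : α < 1 := max_lt (by norm_num) (by nlinarith [pow_pos hp 2])
  obtain ⟨κ, hκ0, hκ1, hκ⟩ := pow_div_le_mul_pow hα0 hα1 m
  refine ⟨2 * α⁻¹, κ, by positivity, hκ0, hκ1, fun μ ν hμ hν hμX hνX f hf1 hfl k => ?_⟩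
  have hfm : BoundedMeasurable f := ⟨hfl.continuous.measurable, 1, hf1⟩
  have hf : TruncLipschitzOn δ 2 X f := by
    intro x _ y _
    have h1 : |f x - f y| ≤ 2 := by
      have := abs_sub (f x) (f y)
      linarith [hf1 x, hf1 y]
    have h2 : |f x - f y| ≤ ‖x - y‖ := by
      have := hfl.dist_le_mul x y
      rwa [NNReal.coe_one, one_mul, dist_eq_norm, dist_eq_norm] at this
    rcases le_total 1 (‖x - y‖ / δ) with h | h
    · rw [min_eq_left h]; linarith
    · rw [min_eq_right h]
      have : ‖x - y‖ ≤ ‖x - y‖ / δ := by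
        rw [le_div_iff₀ hδ0]
        exact mul_le_of_le_one_right (norm_nonneg _) hδ1
      linarith [norm_nonneg (x - y)]
  have hiter : ∀ n : ℕ, TruncLipschitzOn δ (α ^ n * 2) X ((average ℓ F)^[(m + 1) * n] f) := by
    intro n
    induction n with
    | zero => simpa using hf
    | succ n ih =>
      rw [show (m + 1) * (n + 1) = (m + 1) + (m + 1) * n by ring, Function.iterate_add_apply,
        pow_succ', mul_assoc α]
      exact ih.iterate_average_contraction hFm hK hℓK hXm hXK hδ0 hCδ hhδ hp.le
        (fun u hu => hvisit u (mem_closedBall_zero_iff.1 (hXR hu))) (by positivity)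
        (hfm.iterate_average hFm _)
  -- Each full block of `m + 1` steps contracts; the `k % (m + 1)` leftover steps do no harm.
  have hk : TruncLipschitzOn δ (α ^ (k / (m + 1)) * 2) X ((average ℓ F)^[k] f) := by
    conv => arg 4; rw [← Nat.mod_add_div k (m + 1)]
    rw [Function.iterate_add_apply]
    exact (hiter (k / (m + 1))).iterate_average hFm hK hℓK hXK hδ0 hCδ hhδ (by positivity)
      (hfm.iterate_average hFm _) _
  rw [integral_iterate_stepLaw hFm hfm, integral_iterate_stepLaw hFm hfm]
  -- With `B = ∅` and `p = 0` this is just the bound by the oscillation on `X`.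
  have h1 := abs_integral_sub_integral_le (hfm.iterate_average (ℓ := ℓ) hFm k) (X := X) (B := ∅)
    MeasurableSet.empty (p := 0) (by positivity) le_rfl
    (fun x hx y hy => hk.abs_sub_le (by positivity) hx hy) (fun x hx => absurd hx.2 (by simp))
    μ ν hμX hνX (by simp) (by simp)
  refine h1.trans ?_
  have := hκ k
  linarith

end Mixing

/-! ### From the compact invariant set to balls. -/

section BallMixing

variable {ι H E V : Type*} [NormedAddCommGroup H] [InnerProductSpace ℝ H]
  [NormedAddCommGroup E] [InnerProductSpace ℝ E] [NormedAddCommGroup V] [NormedSpace ℝ V]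
  {emb : V →L[ℝ] H} {S : H × E → V} {γ β R : ℝ} {K : Set E}

/-- The condition on `R` says `γ * R + β ≤ R`, so the ball is invariant. Its image in `V` under one
step is bounded, hence relatively compact in `H`. -/
theorem Dissipative.exists_isCompact (hemb : IsCompactOperator emb) (hS : Regular S)
    (hD : Dissipative (fun z => emb (S z)) K γ β) (hK : Bornology.IsBounded K)
    (hR : β / (1 - γ) ≤ R) : ∃ X : Set H, IsCompact X ∧ X ⊆ Metric.closedBall 0 R ∧
      ∀ u ∈ Metric.closedBall 0 R, ∀ ζ ∈ K, emb (S (u, ζ)) ∈ X := by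
  refine ⟨closure (emb '' (S '' (Metric.closedBall 0 R ×ˢ K))), ?_, ?_, ?_⟩
  · exact hemb.isCompact_closure_image_of_bounded (f := (emb : V →ₗ[ℝ] H))
      (hS.isBounded_image (Metric.isBounded_closedBall.prod hK))
  · refine closure_minimal ?_ Metric.isClosed_closedBall
    rintro _ ⟨_, ⟨⟨u, ζ⟩, ⟨hu, hζ⟩, rfl⟩, rfl⟩
    rw [mem_closedBall_zero_iff]
    refine (hD.bound u ζ hζ).trans ?_
    have h1 : ‖u‖ ≤ R := mem_closedBall_zero_iff.1 hu
    have h2 := hD.gamma_lt_one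
    rw [div_le_iff₀ (by linarith)] at hR
    nlinarith [hD.gamma_pos]
  · intro u hu ζ hζ
    exact subset_closure ⟨_, ⟨(u, ζ), ⟨hu, hζ⟩, rfl⟩, rfl⟩

variable [MeasurableSpace H] [BorelSpace H] [MeasurableSpace E] [BorelSpace E]

/-- Exponential mixing for initial laws on a ball. -/
theorem exists_mixing_on_ball {ℓ : Measure E} [IsProbabilityMeasure ℓ] (e : HilbertBasis ι ℝ E)
    (hemb : IsCompactOperator emb) (hS : Regular S) (hm : Measurable fun z => emb (S z))
    (hs : ∀ j, ShearStable ℓ (e j)) (hK : IsCompact ℓ.support) (hℓ : ℓ ℓ.supportᶜ = 0)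
    (h0 : (0 : E) ∈ ℓ.support) (hD : Dissipative (fun z => emb (S z)) ℓ.support γ β)
    (hN : NonDegenerate emb S ℓ.support) (hR : β / (1 - γ) ≤ R) :
    ∃ A κ : ℝ, 0 < A ∧ 0 < κ ∧ κ < 1 ∧ ∀ μ ν : Measure H, IsProbabilityMeasure μ →
      IsProbabilityMeasure ν → SupportedByBall μ R → SupportedByBall ν R → ∀ f : H → ℝ,
        (∀ x, |f x| ≤ 1) → LipschitzWith 1 f → ∀ k : ℕ,
          |∫ x, f x ∂((stepLaw ℓ fun z => emb (S z))^[k] μ) -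
            ∫ x, f x ∂((stepLaw ℓ fun z => emb (S z))^[k] ν)| ≤ A * κ ^ k := by
  have hR0 : 0 < R := lt_of_lt_of_le (div_pos hD.beta_pos (by linarith [hD.gamma_lt_one])) hR
  obtain ⟨X, hX, hXR, hXK⟩ := hD.exists_isCompact hemb hS hK.isBounded hR
  obtain ⟨δ₀, hδ₀, C, hh⟩ := exists_almostPreserves_halving e hemb hS hN hs hK hX
  obtain ⟨A, κ, hA, hκ0, hκ1, hmix⟩ := exists_mixing_of_halving hm (hS.clm_comp emb) h0
    hD.gamma_pos hD.gamma_lt_one hD.bound_zero hR0 hK.isClosed.measurableSet hℓ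
    hX.isClosed.measurableSet hXR (fun u hu => hXK u (hXR hu)) hδ₀ hh
  -- The value `2` covers `k = 0`. The quotient `A / κ` pays for the one step needed to enter `X`.
  refine ⟨max 2 (A / κ), κ, by positivity, hκ0, hκ1, fun μ ν hμ hν hμR hνR f hf1 hfl k => ?_⟩
  cases k with
  | zero =>
    rw [pow_zero, mul_one]
    refine le_trans ?_ (le_max_left _ _)
    have hb : ∀ ρ : Measure H, IsProbabilityMeasure ρ → |∫ x, f x ∂ρ| ≤ 1 := fun ρ _ => by
      simpa using norm_integral_le_of_norm_le_const (μ := ρ) (f := f) (.of_forall hf1)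
    have := abs_sub (∫ x, f x ∂μ) (∫ x, f x ∂ν)
    have h1 := hb μ hμ
    have h2 := hb ν hν
    simp only [Function.iterate_zero, id]
    linarith
  | succ k =>
    rw [Function.iterate_succ_apply, Function.iterate_succ_apply]
    refine (hmix _ _ (isProbabilityMeasure_stepLaw hm μ) (isProbabilityMeasure_stepLaw hm ν)
      (stepLaw_compl_eq_zero hm μ hμR hℓ hX.isClosed.measurableSet hXK)
      (stepLaw_compl_eq_zero hm ν hνR hℓ hX.isClosed.measurableSet hXK) f hf1 hfl k).trans ?_
    calc A * κ ^ k = A / κ * κ ^ (k + 1) := by rw [pow_succ]; field_simp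
      _ ≤ _ := by gcongr; exact le_max_right _ _

end BallMixing

/-! ### Existence and stability of the stationary measure. -/

section Stationary

/-- Dividing by a large constant makes any bounded Lipschitz function admissible for the dual
distance. This links mixing to the criterion for weak convergence by bounded Lipschitz functions. -/
theorem tendsto_integral_sub_of_lipschitz {X : Type*} [PseudoMetricSpace X] [Nonempty X]
    [MeasurableSpace X] {μs νs : ℕ → Measure X}
    (h : ∀ f : X → ℝ, (∀ x, |f x| ≤ 1) → LipschitzWith 1 f →
      Tendsto (fun k => ∫ x, f x ∂(μs k) - ∫ x, f x ∂(νs k)) atTop (𝓝 0))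
    {f : X → ℝ} (hb : ∃ C, ∀ x y, dist (f x) (f y) ≤ C) (hl : ∃ L, LipschitzWith L f) :
    Tendsto (fun k => ∫ x, f x ∂(μs k) - ∫ x, f x ∂(νs k)) atTop (𝓝 0) := by
  obtain ⟨C, hC⟩ := hb
  obtain ⟨L, hL⟩ := hl
  obtain ⟨x₀⟩ := ‹Nonempty X›
  set s : ℝ := max (L : ℝ) (|f x₀| + C) + 1 with hs
  have hs0 : 0 < s := by
    have : (0 : ℝ) ≤ L := L.2
    have := this.trans (le_max_left (L : ℝ) (|f x₀| + C))
    linarith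
  have h1 := h (fun x => f x / s) (fun x => by
    rw [abs_div, abs_of_pos hs0, div_le_one hs0]
    have h2 := hC x x₀
    rw [Real.dist_eq] at h2
    have h3 := abs_sub_abs_le_abs_sub (f x) (f x₀)
    have h4 := le_max_right (L : ℝ) (|f x₀| + C)
    linarith) (LipschitzWith.of_dist_le_mul fun x y => by
    rw [Real.dist_eq, ← sub_div, abs_div, abs_of_pos hs0, NNReal.coe_one, one_mul,
      div_le_iff₀ hs0]
    refine (hL.dist_le_mul x y).trans ?_
    rw [mul_comm]
    refine mul_le_mul_of_nonneg_left ?_ dist_nonneg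
    have := le_max_left (L : ℝ) (|f x₀| + C)
    linarith)
  have h2 := h1.const_mul s
  rw [mul_zero] at h2
  refine h2.congr fun k => ?_
  rw [integral_div, integral_div]
  field_simp

variable {H E : Type*} [NormedAddCommGroup H] [MeasurableSpace H] [BorelSpace H]
  [TopologicalSpace E] [MeasurableSpace E] {ℓ : Measure E} [IsProbabilityMeasure ℓ]
  {F : H × E → H}

theorem continuous_average (hF : Continuous F) (hFm : Measurable F)
    (f : BoundedContinuousFunction H ℝ) : Continuous (average ℓ F f) := by
  refine continuous_of_dominated (bound := fun _ => ‖f‖) (fun u => ?_) (fun u => ?_)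
    (integrable_const _) ?_
  · exact (f.continuous.measurable.comp (hFm.comp measurable_prodMk_left)).aestronglyMeasurable
  · exact .of_forall fun ζ => f.norm_coe_le_norm _
  · exact .of_forall fun ζ => by fun_prop

/-- `stepLaw` as a map of probability measures. -/
noncomputable def stepProb (ℓ : Measure E) [IsProbabilityMeasure ℓ] (hFm : Measurable F)
    (μ : ProbabilityMeasure H) : ProbabilityMeasure H :=
  ⟨stepLaw ℓ F μ, isProbabilityMeasure_stepLaw hFm _⟩

/-- The Feller property `continuous_average`, read by duality. -/
theorem tendsto_stepProb (hF : Continuous F) (hFm : Measurable F) {μs : ℕ → ProbabilityMeasure H}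
    {μ : ProbabilityMeasure H} (h : Tendsto μs atTop (𝓝 μ)) :
    Tendsto (fun k => stepProb ℓ hFm (μs k)) atTop (𝓝 (stepProb ℓ hFm μ)) := by
  rw [ProbabilityMeasure.tendsto_iff_forall_integral_tendsto] at h ⊢
  intro f
  have hfm : BoundedMeasurable f := ⟨f.continuous.measurable, ‖f‖, f.norm_coe_le_norm⟩
  obtain ⟨a, ha⟩ := (hfm.average (ℓ := ℓ) hFm).bounded
  have h1 := h (BoundedContinuousFunction.ofNormedAddCommGroup _
    (continuous_average (ℓ := ℓ) hF hFm f) a ha)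
  simp only [BoundedContinuousFunction.coe_ofNormedAddCommGroup] at h1
  simp only [stepProb, ProbabilityMeasure.coe_mk]
  rw [integral_stepLaw hFm hfm]
  simp_rw [integral_stepLaw hFm hfm]
  exact h1

/-- Mixing on balls implies existence and stability of a stationary measure. -/
theorem exists_stationary [SecondCountableTopology H] (hF : Continuous F)
    (hFm : Measurable F) {K : Set E} (hℓK : ℓ Kᶜ = 0) {R₀ : ℝ} (hR₀ : 0 ≤ R₀)
    (hcpt : ∃ X : Set H, IsCompact X ∧ X ⊆ Metric.closedBall 0 R₀ ∧
      ∀ u ∈ Metric.closedBall 0 R₀, ∀ ζ ∈ K, F (u, ζ) ∈ X)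
    (hmix : ∀ R, R₀ ≤ R → ∃ A κ : ℝ, 0 < A ∧ 0 < κ ∧ κ < 1 ∧ ∀ μ ν : Measure H,
      IsProbabilityMeasure μ → IsProbabilityMeasure ν → SupportedByBall μ R → SupportedByBall ν R →
        ∀ f : H → ℝ, (∀ x, |f x| ≤ 1) → LipschitzWith 1 f → ∀ k : ℕ,
          |∫ x, f x ∂((stepLaw ℓ F)^[k] μ) - ∫ x, f x ∂((stepLaw ℓ F)^[k] ν)| ≤ A * κ ^ k) :
    ∃ μ : Measure H, IsProbabilityMeasure μ ∧ stepLaw ℓ F μ = μ ∧ SupportedByBall μ R₀ ∧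
      ∀ ν : Measure H, IsProbabilityMeasure ν →
        WeaklyConverges (fun k => (stepLaw ℓ F)^[k] ν) μ := by
  obtain ⟨X, hX, hXR, hXK⟩ := hcpt
  have hmix0 : ∀ R, R₀ ≤ R → ∀ μ ν : Measure H, IsProbabilityMeasure μ → IsProbabilityMeasure ν →
      SupportedByBall μ R → SupportedByBall ν R → ∀ f : H → ℝ, (∃ C, ∀ x y, dist (f x) (f y) ≤ C) →
        (∃ L, LipschitzWith L f) → Tendsto (fun k => ∫ x, f x ∂((stepLaw ℓ F)^[k] μ) -
          ∫ x, f x ∂((stepLaw ℓ F)^[k] ν)) atTop (𝓝 0) := by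
    intro R hR μ ν hμ hν hμR hνR f hb hl
    obtain ⟨A, κ, -, hκ0, hκ1, hA⟩ := hmix R hR
    refine tendsto_integral_sub_of_lipschitz (fun g hg1 hgl => ?_) hb hl
    refine squeeze_zero_norm (hA μ ν hμ hν hμR hνR g hg1 hgl) ?_
    simpa using (tendsto_pow_atTop_nhds_zero_of_lt_one hκ0.le hκ1).const_mul A
  have hdirac : ∀ (u : H) (R : ℝ), ‖u‖ ≤ R → SupportedByBall (Measure.dirac u) R := by
    intro u R hu
    rw [SupportedByBall, Measure.dirac_apply' _ Metric.isClosed_closedBall.measurableSet.compl]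
    simpa using hu
  -- The index `k + 1` puts every law on the compact set `X`, since one step from `0` enters it;
  -- tightness is then immediate.
  let P : ℕ → ProbabilityMeasure H := fun k =>
    ⟨(stepLaw ℓ F)^[k + 1] (Measure.dirac 0), isProbabilityMeasure_iterate_stepLaw hFm _ _⟩
  have hstep0 : stepLaw ℓ F (Measure.dirac 0) Xᶜ = 0 :=
    stepLaw_compl_eq_zero hFm _ (hdirac 0 R₀ (by simpa using hR₀)) hℓK hX.isClosed.measurableSet hXK
  have hprob0 := isProbabilityMeasure_stepLaw (ℓ := ℓ) hFm (Measure.dirac (0 : H))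
  have hPX : ∀ k, (P k : Measure H) Xᶜ = 0 := by
    intro k
    change (stepLaw ℓ F)^[k + 1] (Measure.dirac 0) Xᶜ = 0
    rw [Function.iterate_succ_apply]
    exact iterate_stepLaw_compl_eq_zero hFm _ hstep0 hℓK hX.isClosed.measurableSet
      (fun u hu => hXK u (hXR hu)) k
  have htight : IsTightMeasureSet {((μ : ProbabilityMeasure H) : Measure H) | μ ∈ Set.range P} := by
    rw [isTightMeasureSet_iff_exists_isCompact_measure_compl_le]
    intro ε _
    refine ⟨X, hX, ?_⟩
    rintro _ ⟨_, ⟨k, rfl⟩, rfl⟩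
    rw [hPX k]
    exact zero_le
  obtain ⟨μ, -, φ, hφ, hlim⟩ := (isCompact_closure_of_isTightMeasureSet htight).tendsto_subseq
    (x := P) fun k => subset_closure ⟨k, rfl⟩
  have hμprob : IsProbabilityMeasure (μ : Measure H) := μ.2
  have hμX : (μ : Measure H) Xᶜ = 0 := by
    rw [prob_compl_eq_zero_iff hX.isClosed.measurableSet]
    refine le_antisymm prob_le_one ?_
    have h1 := ProbabilityMeasure.limsup_measure_closed_le_of_tendsto hlim hX.isClosed
    have h2 : ∀ k, ((P ∘ φ) k : Measure H) X = 1 := fun k =>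
      (prob_compl_eq_zero_iff hX.isClosed.measurableSet).1 (hPX _)
    simp only [h2, limsup_const] at h1
    exact h1
  have hball : ∀ {ρ : Measure H}, ρ Xᶜ = 0 → SupportedByBall ρ R₀ := fun h =>
    measure_mono_null (Set.compl_subset_compl.2 hXR) h
  have hμR := hball hμX
  have hstat : stepLaw ℓ F μ = μ := by
    have h1 := tendsto_stepProb (ℓ := ℓ) hF hFm hlim
    -- Mixing from the initial laws `δ_0` and `stepLaw ℓ F δ_0` shows that consecutive laws of the
    -- chain merge, so the sequence advanced by one step has the same limit. No time averaging is
    -- needed.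
    have h2 : Tendsto (fun k => stepProb ℓ hFm ((P ∘ φ) k)) atTop (𝓝 μ) := by
      rw [tendsto_iff_forall_lipschitz_integral_tendsto] at hlim ⊢
      intro f hb hl
      have h3 := hmix0 R₀ le_rfl (stepLaw ℓ F (Measure.dirac 0)) (Measure.dirac 0) hprob0
        inferInstance (hball hstep0) (hdirac 0 R₀ (by simpa using hR₀)) f hb hl
      have h4 := (h3.comp (tendsto_add_atTop_nat 1)).comp hφ.tendsto_atTop
      have h5 := h4.add (hlim f hb hl)
      rw [zero_add] at h5
      refine h5.congr fun k => ?_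
      simp only [Function.comp, P, stepProb, ProbabilityMeasure.coe_mk]
      rw [← Function.iterate_succ_apply, Function.iterate_succ_apply' _ (φ k + 1)]
      ring
    exact congrArg (fun ρ : ProbabilityMeasure H => (ρ : Measure H)) (tendsto_nhds_unique h1 h2)
  have hstatk : ∀ k, (stepLaw ℓ F)^[k] (μ : Measure H) = μ := fun k =>
    Function.iterate_fixed hstat k
  refine ⟨μ, hμprob, hstat, hμR, fun ν hν => ?_⟩
  let Q : ℕ → ProbabilityMeasure H := fun k =>
    ⟨(stepLaw ℓ F)^[k] ν, isProbabilityMeasure_iterate_stepLaw hFm _ _⟩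
  have hQ : Tendsto Q atTop (𝓝 μ) := by
    rw [tendsto_iff_forall_lipschitz_integral_tendsto]
    intro f hb hl
    have hfm : BoundedMeasurable f := by
      obtain ⟨C, hC⟩ := hb
      refine ⟨hl.choose_spec.continuous.measurable, |f 0| + C, fun x => ?_⟩
      have h2 := hC x 0
      rw [Real.dist_eq] at h2
      linarith [abs_sub_abs_le_abs_sub (f x) (f 0)]
    -- Every point lies in some ball on which mixing holds. The rate depends on `u`, but pointwise
    -- convergence suffices for dominated convergence under `ν`.
    have hpt : ∀ u, Tendsto (fun k => (average ℓ F)^[k] f u) atTop (𝓝 (∫ x, f x ∂μ)) := by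
      intro u
      have h1 := hmix0 (max R₀ ‖u‖) (le_max_left _ _) (Measure.dirac u) μ inferInstance hμprob
        (hdirac u _ (le_max_right _ _))
        (measure_mono_null (Set.compl_subset_compl.2
          (Metric.closedBall_subset_closedBall (le_max_left _ _))) hμR) f hb hl
      have h2 := h1.add_const (∫ x, f x ∂μ)
      rw [zero_add] at h2
      refine h2.congr fun k => ?_
      rw [hstatk, iterate_average_eq_integral hFm hfm]
      ring
    obtain ⟨a, ha⟩ := hfm.bounded
    have hlim2 := tendsto_integral_of_dominated_convergence (μ := ν) (fun _ => a)
      (F := fun k u => (average ℓ F)^[k] f u) (f := fun _ => ∫ x, f x ∂μ)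
      (fun k => (hfm.iterate_average hFm k).measurable.aestronglyMeasurable)
      (integrable_const _) (fun k => .of_forall fun u => by
        rw [iterate_average_eq_integral hFm hfm]
        have := isProbabilityMeasure_iterate_stepLaw (ℓ := ℓ) hFm (Measure.dirac u) k
        simpa using norm_integral_le_of_norm_le_const
          (μ := (stepLaw ℓ F)^[k] (Measure.dirac u)) (f := f) (.of_forall ha))
      (.of_forall hpt)
    simp only [integral_const, probReal_univ, one_smul] at hlim2
    refine hlim2.congr fun k => ?_
    simp only [Q, ProbabilityMeasure.coe_mk]
    rw [integral_iterate_stepLaw hFm hfm]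
  rw [ProbabilityMeasure.tendsto_iff_forall_integral_tendsto] at hQ
  exact hQ

end Stationary

/-! ### Trajectories, iterates of the one-step law, and the Markov property. -/

section Path

variable {H E : Type*}

/-- The trajectory issued from a point `x` for a given sequence `y` of noises. -/
def path (F : H × E → H) : ℕ → H → (ℕ → E) → H
  | 0, x, _ => x
  | k + 1, x, y => F (path F k x y, y k)

theorem trajectory_eq_path {Ω : Type*} (F : H × E → H) (η : ℕ → Ω → E) (v : Ω → H) (k : ℕ) (ω : Ω) :
    trajectory F η v k ω = path F k (v ω) fun j => η j ω := by
  induction k with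
  | zero => rfl
  | succ k ih => simp only [trajectory, path, ih]

theorem path_add (F : H × E → H) (k n : ℕ) (x : H) (y : ℕ → E) :
    path F (k + n) x y = path F n (path F k x y) fun j => y (k + j) := by
  induction n with
  | zero => rfl
  | succ n ih => rw [← add_assoc]; simp only [path, ih]

theorem path_congr (F : H × E → H) {k : ℕ} (x : H) {y y' : ℕ → E} (h : ∀ i < k, y i = y' i) :
    path F k x y = path F k x y' := by
  induction k with
  | zero => rfl
  | succ k ih =>
    simp only [path]
    rw [ih fun i hi => h i (hi.trans k.lt_succ_self), h k k.lt_succ_self]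

variable [MeasurableSpace H] [MeasurableSpace E] {F : H × E → H}

theorem measurable_path (hF : Measurable F) (k : ℕ) :
    Measurable fun p : H × (ℕ → E) => path F k p.1 p.2 := by
  induction k with
  | zero => exact measurable_fst
  | succ k ih =>
    exact hF.comp (ih.prodMk ((measurable_pi_apply k).comp measurable_snd))

variable {Ω : Type*} [MeasurableSpace Ω] {Pr : Measure Ω} {η : ℕ → Ω → E} {ℓ : Measure E}

theorem IsIIDWithLaw.map_seq (hη : IsIIDWithLaw Pr η ℓ) :
    Pr.map (fun ω k => η k ω) = Measure.infinitePi fun _ : ℕ => ℓ := by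
  rw [hη.indep.map_fun_eq_infinitePi_map hη.measurable]
  simp only [hη.law]

theorem IsIIDWithLaw.measurable_seq (hη : IsIIDWithLaw Pr η ℓ) : Measurable fun ω k => η k ω :=
  measurable_pi_iff.2 hη.measurable

theorem IsIIDWithLaw.map_shift (hη : IsIIDWithLaw Pr η ℓ) (k : ℕ) :
    Pr.map (fun ω j => η (k + j) ω) = Measure.infinitePi fun _ : ℕ => ℓ := by
  have h : iIndepFun (fun j => η (k + j)) Pr := hη.indep.precomp (add_right_injective k)
  rw [h.map_fun_eq_infinitePi_map fun j => hη.measurable _]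
  simp only [hη.law]

theorem transition_eq (hF : Measurable F) (hη : IsIIDWithLaw Pr η ℓ) (k : ℕ) (u : H) :
    transition Pr F η k u = (Measure.infinitePi fun _ : ℕ => ℓ).map (path F k u) := by
  have h : Measurable (path F k u) := (measurable_path hF k).comp measurable_prodMk_left
  rw [transition, ← hη.map_seq, Measure.map_map h hη.measurable_seq]
  congr 1
  funext ω
  exact trajectory_eq_path F η _ k ω

variable [IsProbabilityMeasure Pr]

theorem evolve_eq (hF : Measurable F) (hη : IsIIDWithLaw Pr η ℓ) (k : ℕ) (μ : Measure H)
    [IsProbabilityMeasure μ] : evolve Pr F η k μ =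
      (μ.prod (Measure.infinitePi fun _ : ℕ => ℓ)).map fun p => path F k p.1 p.2 := by
  have h1 : μ.prod (Measure.infinitePi fun _ : ℕ => ℓ) =
      (μ.prod Pr).map (Prod.map id fun ω k => η k ω) := by
    rw [← Measure.map_prod_map _ _ measurable_id hη.measurable_seq, Measure.map_id, hη.map_seq]
  rw [evolve, h1, Measure.map_map (measurable_path hF k)
    (measurable_id.prodMap hη.measurable_seq)]
  congr 1
  funext p
  exact trajectory_eq_path F _ _ k p

theorem map_trajectory_eq (hF : Measurable F) (hη : IsIIDWithLaw Pr η ℓ) {v : Ω → H}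
    (hv : Measurable v) (hind : IndepFun v (fun ω k => η k ω) Pr) (k : ℕ) :
    Pr.map (trajectory F η v k) = evolve Pr F η k (Pr.map v) := by
  have hp := Measure.isProbabilityMeasure_map (μ := Pr) hv.aemeasurable
  rw [evolve_eq hF hη, ← hη.map_seq, ← (indepFun_iff_map_prod_eq_prod_map_map hv.aemeasurable
    hη.measurable_seq.aemeasurable).1 hind, Measure.map_map (measurable_path hF k)
    (hv.prodMk hη.measurable_seq)]
  congr 1
  funext ω
  exact trajectory_eq_path F η v k ω

theorem map_infinitePi_head_tail [IsProbabilityMeasure ℓ] : (Measure.infinitePi fun _ : ℕ => ℓ).map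
      (fun y : ℕ → E => (y 0, fun j => y (1 + j))) =
    ℓ.prod (Measure.infinitePi fun _ : ℕ => ℓ) := by
  have hev : IsIIDWithLaw (Measure.infinitePi fun _ : ℕ => ℓ) (fun k (y : ℕ → E) => y k) ℓ :=
    ⟨fun k => measurable_pi_apply k,
      iIndepFun_infinitePi (X := fun _ x => x) fun _ => measurable_id,
      fun k => Measure.infinitePi_map_eval _ k⟩
  have hind : IndepFun (fun y : ℕ → E => y 0) (fun (y : ℕ → E) j => y (1 + j))
      (Measure.infinitePi fun _ : ℕ => ℓ) := by
    have h := indepFun_subfamilies hev.measurable hev.indep (fun _ : Unit => 0)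
      (fun j : ℕ => 1 + j) (by
        rw [Set.disjoint_left]
        rintro _ ⟨_, rfl⟩ ⟨j, hj⟩
        simp at hj)
    exact h.comp (φ := fun a : Unit → E => a ()) (measurable_pi_apply ()) measurable_id
  rw [(indepFun_iff_map_prod_eq_prod_map_map (hev.measurable 0).aemeasurable
    (measurable_pi_iff.2 fun j => hev.measurable (1 + j)).aemeasurable).1 hind, hev.law 0,
    hev.map_shift 1]

/-- The first noise is split off: the rest of the path starts at `F (x, y 0)`, which is independent
of the tail, and the tail has the law of the whole sequence. -/
theorem evolve_eq_iterate_stepLaw [IsProbabilityMeasure ℓ] (hF : Measurable F)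
    (hη : IsIIDWithLaw Pr η ℓ) (k : ℕ)
    (μ : Measure H) [IsProbabilityMeasure μ] : evolve Pr F η k μ = (stepLaw ℓ F)^[k] μ := by
  induction k generalizing μ with
  | zero =>
    rw [evolve_eq hF hη]
    exact Measure.map_fst_prod.trans (by simp)
  | succ k ih =>
    have hp := isProbabilityMeasure_stepLaw (ℓ := ℓ) hF μ
    rw [Function.iterate_succ_apply, ← ih, evolve_eq hF hη, evolve_eq hF hη]
    set Λ := Measure.infinitePi fun _ : ℕ => ℓ with hΛ
    have h1 : (stepLaw ℓ F μ).prod Λ =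
        (μ.prod Λ).map fun p => (F (p.1, p.2 0), fun j => p.2 (1 + j)) := by
      have h2 : (μ.prod ℓ).prod Λ =
          (μ.prod Λ).map fun p => ((p.1, p.2 0), fun j => p.2 (1 + j)) := by
        apply MeasurableEquiv.map_measurableEquiv_injective MeasurableEquiv.prodAssoc
        rw [Measure.prodAssoc_prod, Measure.map_map (by fun_prop) (by fun_prop),
          ← map_infinitePi_head_tail (ℓ := ℓ)]
        conv_lhs => rw [← Measure.map_id (μ := μ)]
        rw [Measure.map_prod_map _ _ measurable_id (by fun_prop)]
        rfl
      rw [stepLaw]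
      conv_lhs => rw [← Measure.map_id (μ := Λ)]
      rw [Measure.map_prod_map _ _ hF measurable_id, h2,
        Measure.map_map (by fun_prop) (by fun_prop)]
      rfl
    rw [h1, Measure.map_map (measurable_path hF k) (by fun_prop)]
    congr 1
    funext p
    rw [add_comm, path_add]
    rfl

/-- The states up to time `k` are functions of `v` and of `η 0, …, η (k - 1)`, which together are
independent of `η k, η (k + 1), …`. -/
theorem indepFun_history (hF : Measurable F) (hη : IsIIDWithLaw Pr η ℓ) [Nonempty E] {v : Ω → H}
    (hv : Measurable v) (hind : IndepFun v (fun ω k => η k ω) Pr) (k : ℕ) :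
    IndepFun (fun ω (j : Fin (k + 1)) => trajectory F η v j ω) (fun ω j => η (k + j) ω) Pr := by
  classical
  obtain ⟨y₀⟩ := ‹Nonempty E›
  let past : Ω → Fin k → E := fun ω i => η i ω
  have hpast : Measurable past := measurable_pi_iff.2 fun i => hη.measurable _
  have hfut : Measurable fun ω j => η (k + j) ω := measurable_pi_iff.2 fun i => hη.measurable _
  have h1 : IndepFun past (fun ω j => η (k + j) ω) Pr :=
    indepFun_subfamilies hη.measurable hη.indep (fun i : Fin k => (i : ℕ)) (fun j : ℕ => k + j) (by
      rw [Set.disjoint_left]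
      rintro _ ⟨i, rfl⟩ ⟨j, hj⟩
      have := i.2
      simp only at hj
      omega)
  have h2 : IndepFun v (fun ω => (past ω, fun j => η (k + j) ω)) Pr :=
    hind.comp (ψ := fun y : ℕ → E => ((fun i : Fin k => y i), fun j => y (k + j))) measurable_id
      (by fun_prop)
  have h3 := indepFun_prodMk_of_indepFun hv hpast hfut h2 h1
  -- The filler `y₀` at indices `≥ k` is never read by the path up to time `k`.
  let ext : (Fin k → E) → ℕ → E := fun a i => if h : i < k then a ⟨i, h⟩ else y₀
  have hext : Measurable ext := by
    refine measurable_pi_iff.2 fun i => ?_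
    by_cases h : i < k
    · simp only [ext, h, dite_true]; fun_prop
    · simp only [ext, h, dite_false]; fun_prop
  have h4 := h3.comp (φ := fun (p : H × (Fin k → E)) (j : Fin (k + 1)) => path F j p.1 (ext p.2))
    (measurable_pi_iff.2 fun j => (measurable_path hF j).comp
      (measurable_fst.prodMk (hext.comp measurable_snd))) measurable_id
  convert h4 using 1
  swap
  · rfl
  funext ω j
  simp only [Function.comp]
  rw [trajectory_eq_path]
  refine path_congr F _ fun i hi => ?_
  have : i < k := by have := j.2; omega
  simp [ext, this, past]

/-- The trajectories form a Markov chain. -/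
theorem isMarkovChain_trajectory [IsProbabilityMeasure ℓ] (hF : Measurable F)
    (hη : IsIIDWithLaw Pr η ℓ) [Nonempty E]
    {v : Ω → H} (hv : Measurable v) (hind : IndepFun v (fun ω k => η k ω) Pr) :
    IsMarkovChain Pr (trajectory F η v) (transition Pr F η) := by
  have hmeas : ∀ k, Measurable (trajectory F η v k) := by
    intro k
    have : trajectory F η v k = fun ω => path F k (v ω) fun j => η j ω :=
      funext fun ω => trajectory_eq_path F η v k ω
    rw [this]
    exact (measurable_path hF k).comp (hv.prodMk hη.measurable_seq)
  have hpath : ∀ n u, Measurable (path F n u) := fun n u =>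
    (measurable_path hF n).comp measurable_prodMk_left
  have htm : ∀ n, Measurable (transition Pr F η n) := by
    intro n
    refine Measure.measurable_of_measurable_coe _ fun A hA => ?_
    simp only [transition_eq hF hη, Measure.map_apply (hpath n _) hA]
    exact measurable_measure_prodMk_left (measurable_path hF n hA)
  have htp : ∀ n u, IsProbabilityMeasure (transition Pr F η n u) := by
    intro n u
    rw [transition_eq hF hη]
    exact Measure.isProbabilityMeasure_map (hpath n u).aemeasurable
  refine ⟨hmeas, htm, htp, fun k n A hA => ?_⟩
  let hist : Ω → Fin (k + 1) → H := fun ω j => trajectory F η v j ω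
  have hhist : Measurable hist := measurable_pi_iff.2 fun j => hmeas _
  have hfut : Measurable fun ω j => η (k + j) ω := measurable_pi_iff.2 fun i => hη.measurable _
  have hcomap :
      (⨆ j : Fin (k + 1), MeasurableSpace.comap (trajectory F η v j) ‹MeasurableSpace H›) =
      MeasurableSpace.comap hist MeasurableSpace.pi := by
    simp only [MeasurableSpace.pi, MeasurableSpace.comap_iSup, MeasurableSpace.comap_comp]
    rfl
  rw [hcomap]
  have hle : MeasurableSpace.comap hist MeasurableSpace.pi ≤ ‹MeasurableSpace Ω› := hhist.comap_le
  have hreal : Measurable fun u => (transition Pr F η n u).real A :=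
    ((Measure.measurable_coe hA).comp (htm n)).ennreal_toReal
  have hpre : MeasurableSet (trajectory F η v (k + n) ⁻¹' A) := hmeas _ hA
  symm
  refine ae_eq_condExp_of_forall_setIntegral_eq hle ((integrable_const 1).indicator hpre) ?_ ?_ ?_
  · intro s _ _
    refine Integrable.integrableOn (Integrable.of_bound
      (hreal.comp (hmeas k)).aestronglyMeasurable 1 (.of_forall fun ω => ?_))
    have := htp n (trajectory F η v k ω)
    rw [Real.norm_of_nonneg measureReal_nonneg]
    exact measureReal_le_one
  · rintro _ ⟨B, hB, rfl⟩ _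
    have hBm : MeasurableSet (hist ⁻¹' B) := hhist hB
    -- The event that the history lies in `B` and the restarted path ends in `A`. By independence
    -- the history may be frozen, and the law of the future noise then yields the transition
    -- probability.
    let D : Set ((Fin (k + 1) → H) × (ℕ → E)) :=
      {p | p.1 ∈ B ∧ path F n (p.1 (Fin.last k)) p.2 ∈ A}
    have hD : MeasurableSet D := by
      refine (measurable_fst hB).inter ?_
      have hlast : Measurable fun p : (Fin (k + 1) → H) × (ℕ → E) => (p.1 (Fin.last k), p.2) := by
        fun_prop
      exact ((measurable_path hF n).comp hlast) hA
    have h1 := measure_preimage_prodMk_eq_lintegral hhist hfut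
      (indepFun_history hF hη hv hind k) hD
    have h2 : (fun ω => (hist ω, fun j => η (k + j) ω)) ⁻¹' D =
        hist ⁻¹' B ∩ trajectory F η v (k + n) ⁻¹' A := by
      ext ω
      simp only [D, Set.mem_preimage, Set.mem_inter_iff]
      refine and_congr Iff.rfl ?_
      simp only [hist, Fin.val_last]
      rw [trajectory_eq_path, trajectory_eq_path, path_add]
    have h3 : ∀ ω, Pr.map (fun ω j => η (k + j) ω) (Prod.mk (hist ω) ⁻¹' D) =
        (hist ⁻¹' B).indicator (fun ω => transition Pr F η n (trajectory F η v k ω) A) ω := by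
      intro ω
      rw [hη.map_shift]
      by_cases hω : hist ω ∈ B
      · rw [Set.indicator_of_mem (show ω ∈ hist ⁻¹' B from hω), transition_eq hF hη,
          Measure.map_apply (hpath n _) hA]
        congr 1
        ext y
        exact and_iff_right hω
      · rw [Set.indicator_of_notMem (show ω ∉ hist ⁻¹' B from hω)]
        have : Prod.mk (hist ω) ⁻¹' D = ∅ := by
          ext y
          exact iff_of_false (fun h => hω h.1) (Set.notMem_empty y)
        rw [this, measure_empty]
    rw [h2, lintegral_congr h3, lintegral_indicator hBm] at h1
    have h4 : ∫ ω in hist ⁻¹' B, (transition Pr F η n (trajectory F η v k ω)).real A ∂Pr =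
        (∫⁻ ω in hist ⁻¹' B, transition Pr F η n (trajectory F η v k ω) A ∂Pr).toReal := by
      refine integral_toReal ?_ (.of_forall fun ω => ?_)
      · exact (((Measure.measurable_coe hA).comp (htm n)).comp (hmeas k)).aemeasurable
      · have := htp n (trajectory F η v k ω)
        exact measure_lt_top _ _
    rw [h4, ← h1, integral_indicator_const _ hpre, smul_eq_mul, mul_one, Measure.real,
      Measure.restrict_apply hpre, Set.inter_comm]
  · have : StronglyMeasurable[MeasurableSpace.comap hist MeasurableSpace.pi]
        fun ω => (transition Pr F η n (trajectory F η v k ω)).real A := by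
      have hlast : Measurable fun x : Fin (k + 1) → H =>
          (transition Pr F η n (x (Fin.last k))).real A :=
        hreal.comp (measurable_pi_apply (Fin.last k))
      exact (hlast.comp (comap_measurable hist)).stronglyMeasurable
    exact this.aestronglyMeasurable

end Path

end RDS

/-! ### Assembly of the theorem. -/

theorem mainTheorem1
    {H E V Ω ι : Type*}
    [NormedAddCommGroup H] [InnerProductSpace ℝ H] [CompleteSpace H]
    [TopologicalSpace.SeparableSpace H] [MeasurableSpace H] [BorelSpace H]
    [NormedAddCommGroup E] [InnerProductSpace ℝ E] [CompleteSpace E]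
    [TopologicalSpace.SeparableSpace E] [MeasurableSpace E] [BorelSpace E]
    [NormedAddCommGroup V] [NormedSpace ℝ V] [CompleteSpace V]
    [MeasurableSpace Ω] (Pr : Measure Ω) [IsProbabilityMeasure Pr] [Countable ι]
    (emb : V →L[ℝ] H) (hemb : RDS.IsCompactDenseEmbedding emb)
    (S : H × E → V) (η : ℕ → Ω → E) (ℓ : Measure E) (hη : RDS.IsIIDWithLaw Pr η ℓ)
    (F : H × E → H) (hF : F = fun z => emb (S z)) (γ β : ℝ)
    (hA1 : RDS.Regular S)
    (hH1 : RDS.Decomposable ι Pr η)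
    (hH2 : RDS.Dissipative F ℓ.support γ β)
    (hH3 : RDS.NonDegenerate emb S ℓ.support) :
    -- the equation defines a Markov chain, and its laws are given by `P_k^*`
    (∀ v : Ω → H, Measurable v → IndepFun v (fun ω k => η k ω) Pr →
      RDS.IsMarkovChain Pr (RDS.trajectory F η v) (RDS.transition Pr F η) ∧
      ∀ k, Pr.map (RDS.trajectory F η v k) = RDS.evolve Pr F η k (Pr.map v)) ∧
    ∃ μstar : Measure H, IsProbabilityMeasure μstar ∧
      -- `μstar` is stationary, and it is the only stationary probability measure
      (∀ k, RDS.evolve Pr F η k μstar = μstar) ∧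
      (∀ μ : Measure H, IsProbabilityMeasure μ → RDS.evolve Pr F η 1 μ = μ → μ = μstar) ∧
      RDS.SupportedByBall μstar (β / (1 - γ)) ∧
      -- exponential mixing for initial laws supported by a ball
      (∀ R : ℝ, β / (1 - γ) ≤ R → ∃ C κ : ℝ, 0 < C ∧ 0 < κ ∧ κ < 1 ∧
        ∀ μ : Measure H, IsProbabilityMeasure μ → RDS.SupportedByBall μ R →
          ∀ k : ℕ, 1 ≤ k → RDS.lipDualDist (RDS.evolve Pr F η k μ) μstar ≤ C * κ ^ k) ∧
      -- weak convergence for arbitrary initial laws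
      (∀ ν : Measure H, IsProbabilityMeasure ν →
        RDS.WeaklyConverges (fun k => RDS.evolve Pr F η k ν) μstar) := by
  subst hF
  have : SecondCountableTopology H := UniformSpace.secondCountable_of_separable H
  have : SecondCountableTopology E := UniformSpace.secondCountable_of_separable E
  have hℓp : IsProbabilityMeasure ℓ := by
    rw [← hη.law 0]
    exact Measure.isProbabilityMeasure_map (hη.measurable 0).aemeasurable
  have hcont : Continuous fun z => emb (S z) := emb.continuous.comp hA1.contDiff.continuous
  have hm : Measurable fun z => emb (S z) := hcont.measurable
  obtain ⟨e, hs, hK, h0⟩ := hH1.noise_properties hη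
  have hℓK : ℓ ℓ.supportᶜ = 0 := Measure.measure_compl_support
  have hmix := fun (R : ℝ) (hR : β / (1 - γ) ≤ R) =>
    RDS.exists_mixing_on_ball e hemb.compact hA1 hm hs hK hℓK h0 hH2 hH3 hR
  have hR₀ : 0 ≤ β / (1 - γ) := div_nonneg hH2.beta_pos.le (by linarith [hH2.gamma_lt_one])
  obtain ⟨μstar, hμp, hstat, hball, hconv⟩ := RDS.exists_stationary hcont hm hℓK hR₀
    (hH2.exists_isCompact hemb.compact hA1 hK.isBounded le_rfl) hmix
  have hfix : ∀ {μ : Measure H}, RDS.stepLaw ℓ (fun z => emb (S z)) μ = μ →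
      ∀ k, (RDS.stepLaw ℓ fun z => emb (S z))^[k] μ = μ := fun h k => Function.iterate_fixed h k
  refine ⟨fun v hv hind => ⟨RDS.isMarkovChain_trajectory hm hη hv hind,
    RDS.map_trajectory_eq hm hη hv hind⟩, μstar, hμp, fun k => ?_, fun μ hμ h1 => ?_, hball,
    fun R hR => ?_, fun ν hν => ?_⟩
  · rw [RDS.evolve_eq_iterate_stepLaw hm hη, hfix hstat]
  · rw [RDS.evolve_eq_iterate_stepLaw hm hη] at h1
    -- Started from a stationary law the sequence of laws is constant, yet it converges weakly to
    -- `μstar`; so the two measures have the same integrals.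
    refine ext_of_forall_integral_eq_of_IsFiniteMeasure fun f => ?_
    refine tendsto_nhds_unique ?_ (hconv μ hμ f)
    simp only [hfix h1]
    exact tendsto_const_nhds
  · obtain ⟨A, κ, hA, hκ0, hκ1, hAκ⟩ := hmix R hR
    refine ⟨A, κ, hA, hκ0, hκ1, fun μ hμ hμR k _ => ?_⟩
    rw [RDS.evolve_eq_iterate_stepLaw hm hη]
    -- The zero function witnesses that the set under the supremum is nonempty.
    refine csSup_le ⟨_, fun _ => 0, by simp, LipschitzWith.const' 0, rfl⟩ ?_
    rintro _ ⟨f, hf1, hfl, rfl⟩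
    have h := hAκ μ μstar hμ hμp hμR (measure_mono_null (Set.compl_subset_compl.2
      (Metric.closedBall_subset_closedBall hR)) hball) f hf1 hfl k
    rwa [hfix hstat] at h
  · simp only [RDS.evolve_eq_iterate_stepLaw hm hη]
    exact hconv ν hν
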